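/- **Setting.** Let $\Omega\subset\mathbb{R}^d$ be closed and convex with $\|x-y\|\le D$ for all $x,y\in\Omega$, let $A\in\mathbb{R}^{m\times d}$ with spectral norm $\|A\|_2$, let $\psi:\mathbb{R}^m\to\mathbb{R}$ be convex and $\rho$-Lipschitz, let $\xi$ be a random variable, and consider $\min_{x\in\Omega}\phi(x)$ with $\phi(x)=\mathrm{E}[f(x;\xi)]+\psi(Ax)$. Let $\mu>0$ and $\gamma=1/(2\mu)$. A function $h$ is called $r$-weakly convex if $h+\frac r2\|\cdot\|^2$ is convex (on $\Omega$). Assume: 1. there is a measurable $g(x;\xi)\in\mathbb{R}^d$ with $\mathrm{E}[g(x;\xi)]\in\partial_F\big(\mathrm{E}[f(\cdot;\xi)]\big)(x)$ (Fréchet subdifferential) and $\mathrm{E}\|g(x;\xi)\|^2\le G^2$ for all $x\in\Omega$; 2. $\phi$ is $\mu$-weakly convex, and $\mathrm{E}[f(x;\xi)]+\frac1{2\gamma}\|x-c\|^2$ is convex in $x$ for every $c$, i.e. $\mathrm{E}[f(\cdot;\xi)]$ is $\gamma^{-1}$-weakly convex; 3. $\phi(x)-\min_{z\in\Omega}\phi(z)\le\Delta_\phi$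 for all $x\in\Omega$, where $\Delta_\phi>0$. **Algorithm.** Let $c_1,c_2>0$, $\alpha>0$, $a>0$, $S\ge 0$, $x_0\in\Omega$, $\eta_s=c_1/s$, $\beta_s=c_2s$. For $s=1,\dots,S$, stage $s$ runs stochastic ADMM from $x_{s-1}$ for $T_s$ iterations on $\mathrm{E}[f(x;\xi)]+\frac1{2\gamma}\|x-x_{s-1}\|^2+\psi(Ax)$: put $u_1=x_{s-1}$, $y_1=Au_1$, $\lambda_1=0$, and for $t=1,\dots,T_s$, with a fresh independent sample $\xi_{s,t}$ of $\xi$ and $v_t=g(u_t;\xi_{s,t})+\gamma^{-1}(u_t-x_{s-1})$, $$u_{t+1}=\arg\min_{u\in\Omega}\ v_t^\top u+\frac{\beta_s}2\Big\|(Au-y_t)-\frac1{\beta_s}\lambda_t\Big\|^2+\frac{(u-u_t)^\top C_s(u-u_t)}{\eta_s},$$ $$y_{t+1}=\arg\min_{y\in\mathbb{R}^m}\ \psi(y)+\frac{\beta_s}2\Big\|(Au_{t+1}-y)-\frac1{\beta_s}\lambda_t\Big\|^2,\qquad \lambda_{t+1}=\lambda_t-\beta_s(Au_{t+1}-y_{t+1}),$$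 where $C_s=aI-\eta_s\beta_sA^\top A$ is required to satisfy $C_s\succeq I$; then $x_s=\frac1{T_s}\sum_{t=1}^{T_s}u_t$. The numbers of iterations are deterministic with $T_s\ge 24\,s\,\gamma\max(a/c_1,\ c_2\|A\|_2^2)$. Finally $\tau\in\{0,\dots,S\}$ is drawn independently of the samples with probabilities proportional to $(\tau+1)^\alpha$, and $x_\tau$ is returned. **Theorem.** Let $\nabla\phi_\gamma(x)=\gamma^{-1}(x-\mathrm{prox}_{\gamma(\phi+\delta_\Omega)}(x))$ be the gradient of the Moreau envelope of $\phi+\delta_\Omega$. Then $$\mathrm{E}\big[\|\nabla\phi_\gamma(x_\tau)\|^2\big]\le\frac{16\mu\Delta_\phi(\alpha+1)}{S+1}+\frac{C(\alpha+1)}{(S+1)\,\alpha^{\mathbb{I}(\alpha<1)}},$$ where $C$ is a constant that depends only on $c_1,c_2,\rho,G,D,\|A\|_2$ and $\mu$. -/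

import Mathlib

open MeasureTheory ProbabilityTheory
open scoped Topology RealInnerProductSpace

noncomputable section

namespace StagewiseADMM

/-- The Fréchet subdifferential of `h` at `x`: all `v` with
`h y ≥ h x + ⟪v, y - x⟫ + o(‖y - x‖)` as `y → x` in the whole space. -/
def frechetSubdiff {E : Type*} [NormedAddCommGroup E] [InnerProductSpace ℝ E]
    (h : E → ℝ) (x : E) : Set E :=
  {v | ∀ ε : ℝ, 0 < ε → ∀ᶠ y in 𝓝 x, h x + ⟪v, y - x⟫ - ε * ‖y - x‖ ≤ h y}

/-- `h` is `r`-weakly convex on `s`: `h + (r / 2) ‖·‖²` is convex on `s`. -/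
def WeaklyConvexOn {E : Type*} [NormedAddCommGroup E] [InnerProductSpace ℝ E]
    (s : Set E) (r : ℝ) (h : E → ℝ) : Prop :=
  ConvexOn ℝ s (fun x => h x + r / 2 * ‖x‖ ^ 2)

/-- A minimizer of `h` over `s` (an arbitrary point if there is none). -/
def argminOn {E : Type*} [Nonempty E] (s : Set E) (h : E → ℝ) : E :=
  Classical.epsilon (fun x => x ∈ s ∧ IsMinOn h s x)

/-- The proximal mapping of `γ (φ + δ_s)`, where `δ_s` is the indicator function of `s`. -/
def prox {E : Type*} [NormedAddCommGroup E] (s : Set E) (φ : E → ℝ) (γ : ℝ) (x : E) : E :=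
  argminOn s (fun z => φ z + 1 / (2 * γ) * ‖z - x‖ ^ 2)

/-- The gradient `∇φ_γ(x) = γ⁻¹ (x - prox_{γ (φ + δ_s)}(x))` of the Moreau envelope
of `φ + δ_s`. -/
def moreauGrad {E : Type*} [NormedAddCommGroup E] [InnerProductSpace ℝ E]
    (s : Set E) (φ : E → ℝ) (γ : ℝ) (x : E) : E :=
  γ⁻¹ • (x - prox s φ γ x)

section Algorithm

variable {d m : ℕ} {U : Type*}

/-- The expected loss `x ↦ E[f(x; ξ)]`. -/
def expectedLoss [MeasurableSpace U] (P : Measure U)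
    (f : EuclideanSpace ℝ (Fin d) → U → ℝ) (x : EuclideanSpace ℝ (Fin d)) : ℝ :=
  ∫ z, f x z ∂P

/-- The objective `φ(x) = E[f(x; ξ)] + ψ(A x)`. -/
def objective [MeasurableSpace U] (P : Measure U)
    (f : EuclideanSpace ℝ (Fin d) → U → ℝ) (ψ : EuclideanSpace ℝ (Fin m) → ℝ)
    (A : EuclideanSpace ℝ (Fin d) →L[ℝ] EuclideanSpace ℝ (Fin m))
    (x : EuclideanSpace ℝ (Fin d)) : ℝ :=
  expectedLoss P f x + ψ (A x)

/-- The matrix `C = a I - η β Aᵀ A`. -/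
def proxMatrix (A : EuclideanSpace ℝ (Fin d) →L[ℝ] EuclideanSpace ℝ (Fin m)) (a η β : ℝ) :
    EuclideanSpace ℝ (Fin d) →L[ℝ] EuclideanSpace ℝ (Fin d) :=
  a • ContinuousLinearMap.id ℝ (EuclideanSpace ℝ (Fin d))
    - (η * β) • ((ContinuousLinearMap.adjoint A).comp A)

/-- The state `(x, y, λ)` of stochastic ADMM. -/
structure ADMMState (d m : ℕ) where
  /-- the primal variable -/
  x : EuclideanSpace ℝ (Fin d)
  /-- the split variable, meant to equal `A x` -/
  y : EuclideanSpace ℝ (Fin m)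
  /-- the multiplier -/
  l : EuclideanSpace ℝ (Fin m)

/-- The primal update: minimize over `Ω` the function
`v ⬝ u + (β / 2) ‖(A u - y) - λ / β‖² + ‖u - x‖²_C / η`, where `v` is a stochastic subgradient. -/
def updateX (Ω : Set (EuclideanSpace ℝ (Fin d)))
    (A : EuclideanSpace ℝ (Fin d) →L[ℝ] EuclideanSpace ℝ (Fin m)) (a η β : ℝ)
    (v : EuclideanSpace ℝ (Fin d)) (p : ADMMState d m) : EuclideanSpace ℝ (Fin d) :=
  argminOn Ω (fun u => ⟪v, u⟫ + β / 2 * ‖(A u - p.y) - (1 / β) • p.l‖ ^ 2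
    + ⟪u - p.x, proxMatrix A a η β (u - p.x)⟫ / η)

/-- The update of the split variable: minimize `ψ(w) + (β / 2) ‖(A x' - w) - λ / β‖²`
over all `w`, where `x'` is the new primal variable. -/
def updateY (ψ : EuclideanSpace ℝ (Fin m) → ℝ)
    (A : EuclideanSpace ℝ (Fin d) →L[ℝ] EuclideanSpace ℝ (Fin m)) (β : ℝ)
    (x' : EuclideanSpace ℝ (Fin d)) (l : EuclideanSpace ℝ (Fin m)) : EuclideanSpace ℝ (Fin m) :=
  argminOn Set.univ (fun w => ψ w + β / 2 * ‖(A x' - w) - (1 / β) • l‖ ^ 2)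

/-- One iteration of stochastic ADMM with stochastic subgradient `v`. -/
def admmStep (Ω : Set (EuclideanSpace ℝ (Fin d))) (ψ : EuclideanSpace ℝ (Fin m) → ℝ)
    (A : EuclideanSpace ℝ (Fin d) →L[ℝ] EuclideanSpace ℝ (Fin m)) (a η β : ℝ)
    (v : EuclideanSpace ℝ (Fin d)) (p : ADMMState d m) : ADMMState d m where
  x := updateX Ω A a η β v p
  y := updateY ψ A β (updateX Ω A a η β v p) p.l
  l := p.l - β • (A (updateX Ω A a η β v p) - updateY ψ A β (updateX Ω A a η β v p) p.l)

/-- The iterates of stochastic ADMM, where `q x z` is the stochastic subgradient at the point `x`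
for the sample `z`, and `ζ 1, ζ 2, …` are the samples. The state with index `k` is the triple
`(x_{k+1}, y_{k+1}, λ_{k+1})`; it starts at `x_1 = x₀`, `y_1 = A x₀`, `λ_1 = 0`. -/
def admmIter (Ω : Set (EuclideanSpace ℝ (Fin d))) (ψ : EuclideanSpace ℝ (Fin m) → ℝ)
    (A : EuclideanSpace ℝ (Fin d) →L[ℝ] EuclideanSpace ℝ (Fin m))
    (q : EuclideanSpace ℝ (Fin d) → U → EuclideanSpace ℝ (Fin d)) (a η β : ℝ)
    (x₀ : EuclideanSpace ℝ (Fin d)) (ζ : ℕ → U) : ℕ → ADMMState d m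
  | 0 => ⟨x₀, A x₀, 0⟩
  | k + 1 =>
    admmStep Ω ψ A a η β (q (admmIter Ω ψ A q a η β x₀ ζ k).x (ζ (k + 1)))
      (admmIter Ω ψ A q a η β x₀ ζ k)

/-- The output `(x_1 + ⋯ + x_t) / t` of stochastic ADMM run for `t` iterations. -/
def sadmm (Ω : Set (EuclideanSpace ℝ (Fin d))) (ψ : EuclideanSpace ℝ (Fin m) → ℝ)
    (A : EuclideanSpace ℝ (Fin d) →L[ℝ] EuclideanSpace ℝ (Fin m))
    (q : EuclideanSpace ℝ (Fin d) → U → EuclideanSpace ℝ (Fin d)) (a η β : ℝ)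
    (x₀ : EuclideanSpace ℝ (Fin d)) (t : ℕ) (ζ : ℕ → U) : EuclideanSpace ℝ (Fin d) :=
  (1 / (t : ℝ)) • ∑ k ∈ Finset.range t, (admmIter Ω ψ A q a η β x₀ ζ k).x

/-- The stagewise averaged solutions `x_0, x_1, x_2, …`: stage `s ≥ 1` runs stochastic ADMM from
`x_{s-1}` for `T s` iterations, with parameters `η s`, `β s` and samples `ζ s 1, ζ s 2, …`, on
`f_s(x) = E[f(x; ξ) + ‖x - x_{s-1}‖² / (2γ)] + ψ(A x)`. If `g` is a stochastic subgradient
of the expected loss, the one used in stage `s` is `g x z + γ⁻¹ (x - x_{s-1})`. -/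
def stagewise (Ω : Set (EuclideanSpace ℝ (Fin d))) (ψ : EuclideanSpace ℝ (Fin m) → ℝ)
    (A : EuclideanSpace ℝ (Fin d) →L[ℝ] EuclideanSpace ℝ (Fin m))
    (g : EuclideanSpace ℝ (Fin d) → U → EuclideanSpace ℝ (Fin d)) (γ a : ℝ) (η β : ℕ → ℝ)
    (T : ℕ → ℕ) (x₀ : EuclideanSpace ℝ (Fin d)) (ζ : ℕ → ℕ → U) :
    ℕ → EuclideanSpace ℝ (Fin d)
  | 0 => x₀
  | s + 1 =>
    sadmm Ω ψ A
      (fun x z => g x z + γ⁻¹ • (x - stagewise Ω ψ A g γ a η β T x₀ ζ s))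
      a (η (s + 1)) (β (s + 1)) (stagewise Ω ψ A g γ a η β T x₀ ζ s) (T (s + 1)) (ζ (s + 1))

end Algorithm

end StagewiseADMM

end

/-!
A stage approximately minimizes the strongly convex function `φ + μ ‖· - c‖²`, where `c` is the
previous averaged point and `1 / (2γ) = μ`. Its exact minimizer is the proximal point `z` of `c`,
and `∇φ_γ(c) = 2μ (c - z)`, so it suffices to bound the weighted average of `E ‖c - z‖²`.

*One stage.* In an ADMM iteration the variational inequality of the primal update and the relation
`-λ ∈ ∂ψ(y)` after the dual update combine into the decrease of a potential
(`admmStep_potential`), up to `(η / 4) ‖v‖²`. Telescoping, and using that the multipliers are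
bounded by the Lipschitz constant of `ψ`, gives a bound for the optimality gap that holds for
every realization of the samples (`sadmm_gap`). Its only uncontrolled term is the noise of the
stochastic subgradients, which is centered because each sample is independent of the past, hence of
the iterate and of the proximal point it is paired with (`integral_noise_eq_zero`). The number of
iterations makes the coefficient of `E ‖c - z‖²` in the bound at most `μ / 8`, and quadratic growth
at `z` (`WeaklyConvexOn.growth`) turns the result into
`E φ(x_{s+1}) ≤ E φ(x_s) - (3μ / 8) E ‖x_s - z_s‖² + K / (s + 1)` (`stage_arithmetic`).

*All stages.* Multiplying by `(s + 1) ^ α`, summing by parts and comparing the sums of powers with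
integrals gives the rate (`weighted_average_le`). No stage follows the last point `x_S`; there
growth at the proximal point bounds `‖x_S - z_S‖²` by a multiple of `Δ` directly.

The subgradients are bounded in mean, so the expected loss is Lipschitz on the domain. This is where
the existence of proximal points and the integrability of the objective along the iterates come
from. Measurability of the iterates holds because all the minimization problems involved have
solutions that depend continuously on their data.
-/

namespace StagewiseADMM

/-! ### Minimizers of weakly convex functions -/

lemma argminOn_spec {E : Type*} [Nonempty E] {s : Set E} {h : E → ℝ}
    (hex : ∃ x ∈ s, IsMinOn h s x) :
    argminOn s h ∈ s ∧ IsMinOn h s (argminOn s h) :=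
  Classical.epsilon_spec (p := fun x => x ∈ s ∧ IsMinOn h s x) hex

/-- The proximal problem of a continuous function on a compact set has a solution. -/
lemma exists_isMinOn_prox_of_isCompact {E : Type*} [NormedAddCommGroup E]
    {s : Set E} (hs : IsCompact s) (hne : s.Nonempty) {φ : E → ℝ}
    (hφ : ContinuousOn φ s) (r : ℝ) (x : E) :
    ∃ z ∈ s, IsMinOn (fun w => φ w + r / 2 * ‖w - x‖ ^ 2) s z :=
  hs.exists_isMinOn hne (hφ.add (by fun_prop))

/-- The proximal map at parameter `r⁻¹`, with its objective written in terms of `r`. -/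
lemma prox_spec {E : Type*} [NormedAddCommGroup E] {s : Set E} {φ : E → ℝ} {r : ℝ} {x : E}
    (hex : ∃ z ∈ s, IsMinOn (fun w => φ w + r / 2 * ‖w - x‖ ^ 2) s z) :
    prox s φ r⁻¹ x ∈ s ∧ IsMinOn (fun w => φ w + r / 2 * ‖w - x‖ ^ 2) s (prox s φ r⁻¹ x) := by
  have e : (fun z => φ z + 1 / (2 * r⁻¹) * ‖z - x‖ ^ 2)
      = fun w => φ w + r / 2 * ‖w - x‖ ^ 2 := by
    funext z
    rw [one_div, mul_inv, inv_inv]; ring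
  unfold prox
  rw [e]
  exact argminOn_spec hex

section Convex

variable {E : Type*} [NormedAddCommGroup E] [InnerProductSpace ℝ E]

/-- First-order optimality along a segment: `b` is the directional derivative. -/
lemma nonneg_of_forall_quadratic_nonneg {b c : ℝ}
    (h : ∀ t : ℝ, 0 < t → t ≤ 1 → 0 ≤ t * b + t ^ 2 * c) : 0 ≤ b := by
  by_contra! hb
  have hc : 0 < |c| + 1 := by positivity
  set t := min 1 (-b / (2 * (|c| + 1))) with ht
  have ht0 : 0 < t := lt_min one_pos (div_pos (by linarith) (by linarith))
  have h1 := h t ht0 (min_le_left _ _)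
  have h2 : t * (2 * (|c| + 1)) ≤ -b := by
    rw [← le_div_iff₀ (by linarith)]; exact min_le_right _ _
  have h3 : 0 ≤ b + t * c := by
    by_contra! h4
    nlinarith
  have h5 : t * c ≤ t * |c| := mul_le_mul_of_nonneg_left (le_abs_self c) ht0.le
  nlinarith

lemma norm_sq_segment (x y c : E) (t : ℝ) :
    ‖x + t • (y - x) - c‖ ^ 2
      = (1 - t) * ‖x - c‖ ^ 2 + t * ‖y - c‖ ^ 2 - t * (1 - t) * ‖x - y‖ ^ 2 := by
  have e1 : x + t • (y - x) - c = (x - c) + t • (y - x) := by abel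
  have e2 : y - c = (x - c) + (y - x) := by abel
  rw [e1, e2, norm_sub_rev x y, norm_add_sq_real, norm_add_sq_real, inner_smul_right, norm_smul,
    mul_pow, Real.norm_eq_abs, sq_abs]
  ring

lemma segment_mem {s : Set E} (hs : Convex ℝ s) {x y : E} (hx : x ∈ s) (hy : y ∈ s) {t : ℝ}
    (ht0 : 0 ≤ t) (ht1 : t ≤ 1) : x + t • (y - x) ∈ s :=
  hs.add_smul_sub_mem hx hy ⟨ht0, ht1⟩

lemma WeaklyConvexOn.le_segment {s : Set E} {r : ℝ} {h : E → ℝ} (hw : WeaklyConvexOn s r h)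
    {x y : E} (hx : x ∈ s) (hy : y ∈ s) {t : ℝ} (ht0 : 0 ≤ t) (ht1 : t ≤ 1) :
    h (x + t • (y - x)) ≤ (1 - t) * h x + t * h y + r / 2 * (t * (1 - t) * ‖x - y‖ ^ 2) := by
  have h1 := hw.2 hx hy (sub_nonneg.2 ht1) ht0 (by ring)
  have e : (1 - t) • x + t • y = x + t • (y - x) := by rw [sub_smul, smul_sub, one_smul]; abel
  have h2 := norm_sq_segment x y 0 t
  simp only [sub_zero] at h2
  rw [e] at h1
  simp only [smul_eq_mul, h2] at h1
  linarith

/-- A Fréchet subgradient of a weakly convex function gives a global lower bound. -/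
lemma WeaklyConvexOn.ge_of_mem_frechetSubdiff {s : Set E} {r : ℝ} {h : E → ℝ}
    (hw : WeaklyConvexOn s r h) {x y v : E} (hx : x ∈ s) (hy : y ∈ s)
    (hv : v ∈ frechetSubdiff h x) :
    h x + ⟪v, y - x⟫ - r / 2 * ‖y - x‖ ^ 2 ≤ h y := by
  refine le_of_forall_pos_le_add fun ε hε => ?_
  have hε' : 0 < ε / (2 * (‖y - x‖ + 1)) := by positivity
  have hεn : ε / (2 * (‖y - x‖ + 1)) * ‖y - x‖ ≤ ε / 2 := by
    rw [div_mul_eq_mul_div, div_le_div_iff₀ (by positivity) (by positivity)]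
    nlinarith [norm_nonneg (y - x)]
  have hcont : Filter.Tendsto (fun t : ℝ => x + t • (y - x)) (𝓝[>] 0) (𝓝 x) := by
    have : ContinuousAt (fun t : ℝ => x + t • (y - x)) 0 := by fun_prop
    have h0 := this.tendsto
    simp only [zero_smul, add_zero] at h0
    exact h0.mono_left nhdsWithin_le_nhds
  have hsmall : ∀ᶠ t : ℝ in 𝓝[>] 0, t * (|r / 2 * ‖y - x‖ ^ 2| + 1) < ε / 2 := by
    have : ContinuousAt (fun t : ℝ => t * (|r / 2 * ‖y - x‖ ^ 2| + 1)) 0 := by fun_prop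
    have h0 := this.tendsto.mono_left (nhdsWithin_le_nhds (s := Set.Ioi (0 : ℝ)))
    exact h0.eventually (gt_mem_nhds (by simpa using half_pos hε))
  have hle1 : ∀ᶠ t : ℝ in 𝓝[>] 0, t < 1 :=
    nhdsWithin_le_nhds (gt_mem_nhds one_pos)
  obtain ⟨t, ht1, ht2, ht3, ht0⟩ := ((hcont.eventually (hv _ hε')).and (hsmall.and
    (hle1.and self_mem_nhdsWithin))).exists
  have ht0 : 0 < t := ht0
  have h1 := hw.le_segment hx hy ht0.le ht3.le
  rw [add_sub_cancel_left, inner_smul_right, norm_smul, Real.norm_eq_abs, abs_of_pos ht0] at ht1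
  rw [norm_sub_rev x y] at h1
  have h4 : t * (r / 2 * ‖y - x‖ ^ 2) ≥ - (ε / 2) := by
    have := neg_abs_le (r / 2 * ‖y - x‖ ^ 2)
    nlinarith
  have h5 : t * (h x + ⟪v, y - x⟫ - r / 2 * ‖y - x‖ ^ 2) ≤ t * (h y + ε) := by
    nlinarith
  exact le_of_mul_le_mul_left h5 ht0

/-- Quadratic growth of `h + (r / 2) ‖· - x‖²` at a minimizer, for `μ`-weakly convex `h`. -/
lemma WeaklyConvexOn.growth {s : Set E} {μ r : ℝ} {h : E → ℝ} (hs : Convex ℝ s)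
    (hw : WeaklyConvexOn s μ h) {x y z : E} (hz : z ∈ s) (hy : y ∈ s)
    (hmin : IsMinOn (fun w => h w + r / 2 * ‖w - x‖ ^ 2) s z) :
    h z + r / 2 * ‖z - x‖ ^ 2 + (r - μ) / 2 * ‖y - z‖ ^ 2 ≤ h y + r / 2 * ‖y - x‖ ^ 2 := by
  have key : 0 ≤ (h y + r / 2 * ‖y - x‖ ^ 2) - (h z + r / 2 * ‖z - x‖ ^ 2)
      - (r - μ) / 2 * ‖y - z‖ ^ 2 := by
    refine nonneg_of_forall_quadratic_nonneg (c := (r - μ) / 2 * ‖y - z‖ ^ 2)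
      fun t ht0 ht1 => ?_
    have h1 := isMinOn_iff.1 hmin _ (segment_mem hs hz hy ht0.le ht1)
    have h2 := hw.le_segment hz hy ht0.le ht1
    simp only [norm_sq_segment] at h1
    rw [norm_sub_rev z y] at h1 h2
    linarith
  linarith

/-- The proximal map of a `μ`-weakly convex function is Lipschitz. -/
lemma norm_prox_sub_le {s : Set E} {φ : E → ℝ} {μ r : ℝ} (hs : Convex ℝ s) (hμr : μ < r)
    (hr : 0 ≤ r) (hw : WeaklyConvexOn s μ φ)
    (hex : ∀ x, ∃ z ∈ s, IsMinOn (fun w => φ w + r / 2 * ‖w - x‖ ^ 2) s z) (x y : E) :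
    ‖prox s φ r⁻¹ x - prox s φ r⁻¹ y‖ ≤ r / (r - μ) * ‖x - y‖ := by
  obtain ⟨hx, hxm⟩ := prox_spec (hex x)
  obtain ⟨hy, hym⟩ := prox_spec (hex y)
  set p := prox s φ r⁻¹ x
  set q := prox s φ r⁻¹ y
  have h1 := hw.growth hs hx hy hxm
  have h2 := hw.growth hs hy hx hym
  rw [norm_sub_rev q p] at h1
  have h3 : ‖q - x‖ ^ 2 - ‖p - x‖ ^ 2 + ‖p - y‖ ^ 2 - ‖q - y‖ ^ 2 = 2 * ⟪p - q, x - y⟫ := by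
    simp only [norm_sub_sq_real, inner_sub_left, inner_sub_right]; ring
  have h4 := real_inner_le_norm (p - q) (x - y)
  have h5 : ‖p - q‖ * ((r - μ) * ‖p - q‖) ≤ ‖p - q‖ * (r * ‖x - y‖) := by
    nlinarith
  rw [div_mul_eq_mul_div, le_div_iff₀ (by linarith)]
  rcases (norm_nonneg (p - q)).eq_or_lt with h0 | h0
  · rw [← h0]; simp; positivity
  · linarith [le_of_mul_le_mul_left h5 h0]

lemma continuous_prox {s : Set E} {φ : E → ℝ} {μ r : ℝ} (hs : Convex ℝ s) (hμr : μ < r)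
    (hr : 0 ≤ r) (hw : WeaklyConvexOn s μ φ)
    (hex : ∀ x, ∃ z ∈ s, IsMinOn (fun w => φ w + r / 2 * ‖w - x‖ ^ 2) s z) :
    Continuous (prox s φ r⁻¹) := by
  refine (LipschitzWith.of_dist_le_mul (K := Real.toNNReal (r / (r - μ))) fun x y => ?_).continuous
  rw [dist_eq_norm, dist_eq_norm, Real.coe_toNNReal _ (div_nonneg hr (by linarith))]
  exact norm_prox_sub_le hs hμr hr hw hex x y

/-- The proximal problem of a Lipschitz function on a finite-dimensional space has a solution,
since the quadratic term dominates far from the center. -/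
lemma exists_isMinOn_prox_of_lipschitz [FiniteDimensional ℝ E] {ψ : E → ℝ} {ρ r : ℝ} (hr : 0 < r)
    (hψ : ∀ u v, |ψ u - ψ v| ≤ ρ * ‖u - v‖) (x : E) :
    ∃ z ∈ Set.univ, IsMinOn (fun w => ψ w + r / 2 * ‖w - x‖ ^ 2) Set.univ z := by
  have hψc : Continuous ψ := by
    refine (LipschitzWith.of_dist_le_mul (K := Real.toNNReal ρ) fun u v => ?_).continuous
    rw [Real.dist_eq, dist_eq_norm]
    exact (hψ u v).trans (mul_le_mul_of_nonneg_right (Real.le_coe_toNNReal ρ) (norm_nonneg _))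
  have : ProperSpace E := FiniteDimensional.proper ℝ E
  refine ContinuousOn.exists_isMinOn' (x₀ := x) (by fun_prop) isClosed_univ (Set.mem_univ x) ?_
  rw [Filter.principal_univ, inf_top_eq]
  filter_upwards [(isCompact_closedBall x (2 * ρ / r)).compl_mem_cocompact] with w hw
  have hw' : 2 * ρ / r < ‖w - x‖ := by simpa [dist_eq_norm] using hw
  rw [div_lt_iff₀ hr] at hw'
  have h1 := (abs_le.1 (hψ w x)).1
  rw [sub_self, norm_zero]
  nlinarith [norm_nonneg (w - x)]

/-- A weakly convex function on a bounded set that has uniformly bounded Fréchet subgradients is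
continuous: exchanging the two points in the subgradient inequality gives a Lipschitz bound. -/
lemma WeaklyConvexOn.continuousOn_of_subgradient {s : Set E} {r G D : ℝ} {h : E → ℝ} (hr : 0 ≤ r)
    (hw : WeaklyConvexOn s r h) (hD : ∀ x ∈ s, ∀ y ∈ s, ‖x - y‖ ≤ D) {v : E → E}
    (hv : ∀ x ∈ s, v x ∈ frechetSubdiff h x) (hG : ∀ x ∈ s, ‖v x‖ ≤ G) :
    ContinuousOn h s := by
  have key : ∀ x ∈ s, ∀ y ∈ s, h x - h y ≤ (G + r / 2 * D) * ‖x - y‖ := by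
    intro x hx y hy
    have h1 := hw.ge_of_mem_frechetSubdiff hx hy (hv x hx)
    have h2 := neg_le_of_abs_le (abs_real_inner_le_norm (v x) (y - x))
    have h3 := mul_le_mul_of_nonneg_right (hG x hx) (norm_nonneg (y - x))
    have h4 := mul_le_mul_of_nonneg_right (hD y hy x hx) (norm_nonneg (y - x))
    rw [norm_sub_rev x y]
    nlinarith
  have hlip : LipschitzOnWith (Real.toNNReal (G + r / 2 * D)) h s := by
    refine LipschitzOnWith.of_dist_le_mul fun x hx y hy => ?_
    have h1 := key x hx y hy
    have h2 := key y hy x hx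
    rw [norm_sub_rev] at h2
    rw [Real.dist_eq, dist_eq_norm]
    refine (abs_le.2 ⟨by linarith, h1⟩).trans ?_
    exact mul_le_mul_of_nonneg_right (Real.le_coe_toNNReal _) (norm_nonneg _)
  exact hlip.continuousOn

end Convex

/-! ### One iteration of ADMM -/

section Step

variable {d m : ℕ} {Ω : Set (EuclideanSpace ℝ (Fin d))}
  {A : EuclideanSpace ℝ (Fin d) →L[ℝ] EuclideanSpace ℝ (Fin m)}
  {ψ : EuclideanSpace ℝ (Fin m) → ℝ} {a η β ρ : ℝ}

lemma inner_proxMatrix (A : EuclideanSpace ℝ (Fin d) →L[ℝ] EuclideanSpace ℝ (Fin m)) (a η β : ℝ)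
    (u w : EuclideanSpace ℝ (Fin d)) :
    ⟪u, proxMatrix A a η β w⟫ = a * ⟪u, w⟫ - η * β * ⟪A u, A w⟫ := by
  simp [proxMatrix, inner_sub_right, inner_smul_right, ContinuousLinearMap.adjoint_inner_right]

lemma norm_sq_le_inner_proxMatrix
    (hC : (proxMatrix A a η β - ContinuousLinearMap.id ℝ _).IsPositive)
    (u : EuclideanSpace ℝ (Fin d)) : ‖u‖ ^ 2 ≤ ⟪u, proxMatrix A a η β u⟫ := by
  have := hC.inner_nonneg_right u
  simp only [sub_apply, ContinuousLinearMap.id_apply, inner_sub_right,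
    real_inner_self_eq_norm_sq] at this
  linarith

lemma inner_proxMatrix_le (hη : 0 < η) (hβ : 0 < β) (u : EuclideanSpace ℝ (Fin d)) :
    ⟪u, proxMatrix A a η β u⟫ ≤ a * ‖u‖ ^ 2 := by
  rw [inner_proxMatrix, real_inner_self_eq_norm_sq, real_inner_self_eq_norm_sq]
  have : 0 ≤ η * β * ‖A u‖ ^ 2 := by positivity
  linarith

/-- The primal update is well defined, and satisfies the variational inequality of its
minimization problem. -/
lemma updateX_spec (hΩc : IsCompact Ω) (hΩ : Convex ℝ Ω) (hne : Ω.Nonempty)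
    (v : EuclideanSpace ℝ (Fin d)) (p : ADMMState d m) :
    updateX Ω A a η β v p ∈ Ω ∧ ∀ y ∈ Ω,
      0 ≤ ⟪v, y - updateX Ω A a η β v p⟫
        + β * ⟪A (updateX Ω A a η β v p) - p.y - (1 / β) • p.l, A (y - updateX Ω A a η β v p)⟫
        + 2 / η * ⟪proxMatrix A a η β (updateX Ω A a η β v p - p.x),
            y - updateX Ω A a η β v p⟫ := by
  set h : EuclideanSpace ℝ (Fin d) → ℝ := fun u => ⟪v, u⟫
    + β / 2 * ‖(A u - p.y) - (1 / β) • p.l‖ ^ 2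
    + ⟪u - p.x, proxMatrix A a η β (u - p.x)⟫ / η with hh
  have hcont : Continuous h := by fun_prop
  obtain ⟨h1, h2⟩ := argminOn_spec (hΩc.exists_isMinOn hne hcont.continuousOn)
  change updateX Ω A a η β v p ∈ Ω at h1
  change IsMinOn h Ω (updateX Ω A a η β v p) at h2
  set z := updateX Ω A a η β v p
  refine ⟨h1, fun y hy => ?_⟩
  refine nonneg_of_forall_quadratic_nonneg
    (c := β / 2 * ‖A (y - z)‖ ^ 2 + ⟪y - z, proxMatrix A a η β (y - z)⟫ / η) fun t ht0 ht1 => ?_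
  have h3 := isMinOn_iff.1 h2 _ (segment_mem hΩ h1 hy ht0.le ht1)
  have e1 : A (z + t • (y - z)) - p.y - (1 / β) • p.l
      = (A z - p.y - (1 / β) • p.l) + t • A (y - z) := by
    rw [map_add, map_smul]; abel
  have e2 : z + t • (y - z) - p.x = (z - p.x) + t • (y - z) := by abel
  have e3 : ∀ w : EuclideanSpace ℝ (Fin d), ⟪z - p.x, proxMatrix A a η β w⟫
      = ⟪proxMatrix A a η β (z - p.x), w⟫ := fun w => by
    rw [real_inner_comm _ (proxMatrix A a η β (z - p.x)), inner_proxMatrix, inner_proxMatrix,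
      real_inner_comm, real_inner_comm (A w)]
  simp only [hh, e1, e2] at h3
  rw [norm_add_sq_real, norm_smul, mul_pow, Real.norm_eq_abs, sq_abs, map_add, map_smul,
    inner_add_right, inner_smul_right, inner_smul_right, inner_add_left, inner_add_right,
    inner_add_right, inner_smul_left, inner_smul_left, inner_smul_right, inner_smul_right,
    e3 (y - z), real_inner_comm (proxMatrix A a η β (z - p.x)) (y - z)] at h3
  simp only [conj_trivial, add_div] at h3
  ring_nf at h3 ⊢
  linarith

lemma updateY_eq_prox (x' : EuclideanSpace ℝ (Fin d)) (l : EuclideanSpace ℝ (Fin m)) :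
    updateY ψ A β x' l = prox Set.univ ψ β⁻¹ (A x' - (1 / β) • l) := by
  unfold updateY prox
  congr 1
  funext w
  have e : A x' - w - (1 / β) • l = - (w - (A x' - (1 / β) • l)) := by abel
  rw [e, norm_neg, one_div (2 * β⁻¹), mul_inv, inv_inv]
  ring

/-- After an update, `-λ` is a subgradient of `ψ` at `y`. -/
lemma updateY_subgradient (hβ : 0 < β) (hψc : ConvexOn ℝ Set.univ ψ)
    (hψ : ∀ u v, |ψ u - ψ v| ≤ ρ * ‖u - v‖) (x' : EuclideanSpace ℝ (Fin d))
    (l w : EuclideanSpace ℝ (Fin m)) :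
    ψ (updateY ψ A β x' l)
      - ⟪l - β • (A x' - updateY ψ A β x' l), w - updateY ψ A β x' l⟫ ≤ ψ w := by
  set q := A x' - (1 / β) • l with hq
  have hw : WeaklyConvexOn Set.univ 0 ψ := by simpa [WeaklyConvexOn] using hψc
  obtain ⟨h1, h2⟩ := prox_spec (exists_isMinOn_prox_of_lipschitz hβ hψ q)
  have h3 := hw.growth convex_univ h1 (Set.mem_univ w) h2
  rw [updateY_eq_prox, ← hq]
  set y' := prox Set.univ ψ β⁻¹ q
  have e1 : l - β • (A x' - y') = β • (y' - q) := by
    rw [hq, sub_sub_eq_add_sub, smul_sub, smul_sub, smul_add, smul_smul, mul_one_div_cancel hβ.ne',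
      one_smul]; abel
  have e2 : w - q = (w - y') + (y' - q) := by abel
  rw [e1, real_inner_smul_left]
  rw [e2, norm_add_sq_real, real_inner_comm (y' - q) (w - y')] at h3
  nlinarith

/-- Subgradients of a `ρ`-Lipschitz function have norm at most `ρ`. -/
lemma norm_le_of_subgradient (hρ : 0 ≤ ρ) (hψ : ∀ u v, |ψ u - ψ v| ≤ ρ * ‖u - v‖)
    {y l : EuclideanSpace ℝ (Fin m)} (h : ∀ w, ψ y - ⟪l, w - y⟫ ≤ ψ w) : ‖l‖ ≤ ρ := by
  have h1 := h (y - l)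
  have h2 := (abs_le.1 (hψ (y - l) y)).2
  have e : y - l - y = - l := by abel
  rw [e, inner_neg_right, real_inner_self_eq_norm_sq] at h1
  rw [e, norm_neg] at h2
  by_contra! h3
  nlinarith

/-- The quantity that decreases along ADMM, up to the error of the stochastic subgradient: the
distance of the state to the reference point `x` with `y = A x` and `λ = 0`. -/
noncomputable def potential (A : EuclideanSpace ℝ (Fin d) →L[ℝ] EuclideanSpace ℝ (Fin m))
    (a η β : ℝ) (x : EuclideanSpace ℝ (Fin d)) (p : ADMMState d m) : ℝ :=
  ⟪p.x - x, proxMatrix A a η β (p.x - x)⟫ / η + ‖p.l‖ ^ 2 / (2 * β) + β / 2 * ‖p.y - A x‖ ^ 2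

lemma potential_nonneg (hη : 0 < η) (hβ : 0 < β)
    (hC : (proxMatrix A a η β - ContinuousLinearMap.id ℝ _).IsPositive)
    (x : EuclideanSpace ℝ (Fin d)) (p : ADMMState d m) : 0 ≤ potential A a η β x p := by
  have h := (sq_nonneg _).trans (norm_sq_le_inner_proxMatrix hC (p.x - x))
  unfold potential
  positivity

/-- The basic inequality of one ADMM iteration. -/
lemma admmStep_potential (hΩc : IsCompact Ω) (hΩ : Convex ℝ Ω) (hη : 0 < η) (hβ : 0 < β)
    (hψc : ConvexOn ℝ Set.univ ψ) (hψ : ∀ u v, |ψ u - ψ v| ≤ ρ * ‖u - v‖)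
    (hC : (proxMatrix A a η β - ContinuousLinearMap.id ℝ _).IsPositive)
    (v : EuclideanSpace ℝ (Fin d)) (p : ADMMState d m) {x : EuclideanSpace ℝ (Fin d)}
    (hx : x ∈ Ω) :
    ⟪v, p.x - x⟫ + ψ (admmStep Ω ψ A a η β v p).y - ψ (A x)
      ≤ potential A a η β x p - potential A a η β x (admmStep Ω ψ A a η β v p)
        + η / 4 * ‖v‖ ^ 2 := by
  obtain ⟨-, h1⟩ := updateX_spec (A := A) (a := a) (η := η) (β := β) hΩc hΩ ⟨x, hx⟩ v p
  have h1 := h1 x hx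
  have h2 := updateY_subgradient (A := A) hβ hψc hψ (updateX Ω A a η β v p) p.l (A x)
  simp only [potential, admmStep]
  set u := updateX Ω A a η β v p
  set y' := updateY ψ A β u p.l
  -- the three-point identity for the norm of the proximal matrix
  have e1 : 2 * ⟪proxMatrix A a η β (u - p.x), x - u⟫
      = ⟪p.x - x, proxMatrix A a η β (p.x - x)⟫ - ⟪u - x, proxMatrix A a η β (u - x)⟫
        - ⟪u - p.x, proxMatrix A a η β (u - p.x)⟫ := by
    rw [real_inner_comm]
    simp only [inner_proxMatrix, map_sub, inner_sub_left, inner_sub_right,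
      real_inner_comm u p.x, real_inner_comm u x, real_inner_comm p.x x,
      real_inner_comm (A u) (A p.x), real_inner_comm (A u) (A x), real_inner_comm (A p.x) (A x)]
    ring
  have e1' : 2 / η * ⟪proxMatrix A a η β (u - p.x), x - u⟫
      = ⟪p.x - x, proxMatrix A a η β (p.x - x)⟫ / η - ⟪u - x, proxMatrix A a η β (u - x)⟫ / η
        - ⟪u - p.x, proxMatrix A a η β (u - p.x)⟫ / η := by
    rw [div_mul_eq_mul_div, e1, sub_div, sub_div]
  -- Young's inequality for the displacement of the primal variable
  have h3 : ⟪v, p.x - u⟫ ≤ η / 4 * ‖v‖ ^ 2 + ⟪u - p.x, proxMatrix A a η β (u - p.x)⟫ / η := by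
    have h4 := real_inner_le_norm v (p.x - u)
    have h5 := div_le_div_of_nonneg_right (norm_sq_le_inner_proxMatrix hC (u - p.x)) hη.le
    have h6 : ‖v‖ * ‖p.x - u‖ ≤ η / 4 * ‖v‖ ^ 2 + ‖u - p.x‖ ^ 2 / η := by
      rw [norm_sub_rev p.x u, ← sub_nonneg]
      have : η / 4 * ‖v‖ ^ 2 + ‖u - p.x‖ ^ 2 / η - ‖v‖ * ‖u - p.x‖
          = (η / 2 * ‖v‖ - ‖u - p.x‖) ^ 2 / η := by
        field_simp; ring
      rw [this]; positivity
    linarith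
  have e2 : ⟪v, p.x - x⟫ = ⟪v, p.x - u⟫ - ⟪v, x - u⟫ := by
    rw [← inner_sub_right]; congr 1; abel
  -- the dual variables: complete the square in `β (A u - p.y) - p.l`
  set r := β • (A u - y') with hr
  have e3 : β * ⟪A u - p.y - (1 / β) • p.l, A (x - u)⟫ + ⟪p.l - r, A x - y'⟫
      + ‖p.l - r‖ ^ 2 / (2 * β) - ‖p.l‖ ^ 2 / (2 * β)
      + β / 2 * ‖y' - A x‖ ^ 2 - β / 2 * ‖p.y - A x‖ ^ 2 ≤ 0 := by
    have hsq : 0 ≤ β / 2 * ‖(y' - p.y) + (A u - y')‖ ^ 2 := by positivity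
    have e4 : β * ⟪A u - p.y - (1 / β) • p.l, A (x - u)⟫
        = β * ⟪A u - p.y, A (x - u)⟫ - ⟪p.l, A (x - u)⟫ := by
      rw [inner_sub_left, real_inner_smul_left]
      field_simp
    have e5 : ‖p.l - r‖ ^ 2 / (2 * β) - ‖p.l‖ ^ 2 / (2 * β)
        = β / 2 * ‖A u - y'‖ ^ 2 - ⟪p.l, A u - y'⟫ := by
      rw [norm_sub_sq_real, hr, norm_smul, real_inner_smul_right, Real.norm_eq_abs, mul_pow,
        sq_abs]
      field_simp
      ring
    have e6 : ⟪p.l - r, A x - y'⟫ = ⟪p.l, A x - y'⟫ - β * ⟪A u - y', A x - y'⟫ := by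
      rw [inner_sub_left, hr, real_inner_smul_left]
    have e7 : A (x - u) = (A x - y') - (A u - y') := by rw [map_sub]; abel
    have e8 : A u - p.y = (A u - y') + (y' - p.y) := by abel
    have e9 : p.y - A x = - ((y' - p.y) + (A x - y')) := by abel
    have e10 : y' - A x = - (A x - y') := by abel
    rw [e7] at e4
    rw [e7, e4, e6, e8, e9, e10, norm_neg, norm_neg]
    generalize A u - y' = b₁ at *
    generalize y' - p.y = b₂ at *
    generalize A x - y' = b₃ at *
    simp only [norm_add_sq_real, inner_sub_right, inner_add_left, real_inner_self_eq_norm_sq]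
      at hsq ⊢
    linarith
  linarith

end Step

/-! ### A full run of ADMM -/

lemma average_mem {E : Type*} [NormedAddCommGroup E] [NormedSpace ℝ E] {s : Set E}
    (hs : Convex ℝ s) {t : ℕ} (ht : 0 < t) {u : ℕ → E} (hu : ∀ k, u k ∈ s) :
    (1 / (t : ℝ)) • ∑ k ∈ Finset.range t, u k ∈ s := by
  have ht' : (t : ℝ) ≠ 0 := by positivity
  rw [Finset.smul_sum]
  exact hs.sum_mem (fun _ _ => by positivity) (by simp [ht']) fun k _ => hu k

lemma mul_average_le_sum {E : Type*} [NormedAddCommGroup E] [NormedSpace ℝ E] {s : Set E}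
    {h : E → ℝ} (hh : ConvexOn ℝ s h) {t : ℕ} (ht : 0 < t) {u : ℕ → E} (hu : ∀ k, u k ∈ s) :
    t * h ((1 / (t : ℝ)) • ∑ k ∈ Finset.range t, u k) ≤ ∑ k ∈ Finset.range t, h (u k) := by
  have ht' : (t : ℝ) ≠ 0 := by positivity
  have h1 := hh.map_sum_le (t := Finset.range t) (w := fun _ => 1 / (t : ℝ)) (p := u)
    (fun _ _ => by positivity) (by simp [ht']) fun k _ => hu k
  rw [← Finset.smul_sum, ← Finset.smul_sum] at h1
  calc (t : ℝ) * h ((1 / (t : ℝ)) • ∑ k ∈ Finset.range t, u k)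
      ≤ t * ((1 / (t : ℝ)) • ∑ k ∈ Finset.range t, h (u k)) :=
        mul_le_mul_of_nonneg_left h1 (by positivity)
    _ = ∑ k ∈ Finset.range t, h (u k) := by rw [smul_eq_mul]; field_simp

section Run

variable {d m : ℕ} {U : Type*} {Ω : Set (EuclideanSpace ℝ (Fin d))}
  {A : EuclideanSpace ℝ (Fin d) →L[ℝ] EuclideanSpace ℝ (Fin m)}
  {ψ : EuclideanSpace ℝ (Fin m) → ℝ} {a η β ρ D : ℝ}
  {q : EuclideanSpace ℝ (Fin d) → U → EuclideanSpace ℝ (Fin d)}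
  {c : EuclideanSpace ℝ (Fin d)} {ζ : ℕ → U}

lemma admmIter_mem (hΩc : IsCompact Ω) (hΩ : Convex ℝ Ω) (hc : c ∈ Ω) (k : ℕ) :
    (admmIter Ω ψ A q a η β c ζ k).x ∈ Ω := by
  cases k with
  | zero => exact hc
  | succ k => exact (updateX_spec hΩc hΩ ⟨c, hc⟩ _ _).1

lemma sadmm_mem (hΩc : IsCompact Ω) (hΩ : Convex ℝ Ω) (hc : c ∈ Ω) {t : ℕ} (ht : 0 < t) :
    sadmm Ω ψ A q a η β c t ζ ∈ Ω :=
  average_mem hΩ ht fun k => admmIter_mem hΩc hΩ hc k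

/-- The multipliers stay bounded, as their negatives are subgradients of `ψ`. -/
lemma norm_admmIter_l_le (hβ : 0 < β) (hρ : 0 ≤ ρ) (hψc : ConvexOn ℝ Set.univ ψ)
    (hψ : ∀ u v, |ψ u - ψ v| ≤ ρ * ‖u - v‖) (k : ℕ) :
    ‖(admmIter Ω ψ A q a η β c ζ k).l‖ ≤ ρ := by
  cases k with
  | zero => simpa [admmIter] using hρ
  | succ k => exact norm_le_of_subgradient hρ hψ (updateY_subgradient hβ hψc hψ _ _)

/-- The basic inequality, telescoped over a run that starts at `(c, A c, 0)`. -/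
lemma sum_admmIter_le (hΩc : IsCompact Ω) (hΩ : Convex ℝ Ω) (hη : 0 < η) (hβ : 0 < β)
    (hψc : ConvexOn ℝ Set.univ ψ) (hψ : ∀ u v, |ψ u - ψ v| ≤ ρ * ‖u - v‖)
    (hC : (proxMatrix A a η β - ContinuousLinearMap.id ℝ _).IsPositive)
    {x : EuclideanSpace ℝ (Fin d)} (hx : x ∈ Ω) (t : ℕ) :
    ∑ k ∈ Finset.range t, (⟪q (admmIter Ω ψ A q a η β c ζ k).x (ζ (k + 1)),
        (admmIter Ω ψ A q a η β c ζ k).x - x⟫ + ψ (admmIter Ω ψ A q a η β c ζ (k + 1)).y - ψ (A x))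
      ≤ (a / η + β * ‖A‖ ^ 2 / 2) * ‖c - x‖ ^ 2
        + η / 4 * ∑ k ∈ Finset.range t,
          ‖q (admmIter Ω ψ A q a η β c ζ k).x (ζ (k + 1))‖ ^ 2 := by
  have h1 := Finset.sum_le_sum fun k (_ : k ∈ Finset.range t) =>
    admmStep_potential hΩc hΩ hη hβ hψc hψ hC (q (admmIter Ω ψ A q a η β c ζ k).x (ζ (k + 1)))
      (admmIter Ω ψ A q a η β c ζ k) hx
  rw [Finset.sum_add_distrib, ← Finset.mul_sum] at h1
  refine h1.trans (add_le_add_left ?_ _)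
  have h2 := Finset.sum_range_sub' (fun k => potential A a η β x (admmIter Ω ψ A q a η β c ζ k)) t
  refine h2.le.trans ?_
  have h3 := potential_nonneg hη hβ hC x (admmIter Ω ψ A q a η β c ζ t)
  have h4 : potential A a η β x (admmIter Ω ψ A q a η β c ζ 0)
      ≤ (a / η + β * ‖A‖ ^ 2 / 2) * ‖c - x‖ ^ 2 := by
    have h5 := div_le_div_of_nonneg_right (inner_proxMatrix_le (A := A) (a := a) hη hβ (c - x))
      hη.le
    have h6 : ‖A c - A x‖ ^ 2 ≤ ‖A‖ ^ 2 * ‖c - x‖ ^ 2 := by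
      rw [← map_sub, ← mul_pow]
      exact pow_le_pow_left₀ (norm_nonneg _) (A.le_opNorm _) 2
    have h7 := mul_le_mul_of_nonneg_left h6 (half_pos hβ).le
    simp only [potential, admmIter, norm_zero, zero_pow two_ne_zero, zero_div, add_zero]
    rw [mul_div_right_comm] at h5
    linarith
  linarith

/-- The constraint residuals telescope to a difference of multipliers. -/
lemma norm_sum_residual_le (hΩc : IsCompact Ω) (hΩ : Convex ℝ Ω) (hc : c ∈ Ω)
    (hD : ∀ x ∈ Ω, ∀ y ∈ Ω, ‖x - y‖ ≤ D) (hβ : 0 < β) (hρ : 0 ≤ ρ)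
    (hψc : ConvexOn ℝ Set.univ ψ) (hψ : ∀ u v, |ψ u - ψ v| ≤ ρ * ‖u - v‖) (t : ℕ) :
    ‖∑ k ∈ Finset.range t, (A (admmIter Ω ψ A q a η β c ζ k).x
        - (admmIter Ω ψ A q a η β c ζ (k + 1)).y)‖ ≤ ρ / β + ‖A‖ * D := by
  set p := admmIter Ω ψ A q a η β c ζ with hp
  have e1 : ∀ k, A (p k).x - (p (k + 1)).y
      = A ((p k).x - (p (k + 1)).x) + β⁻¹ • ((p k).l - (p (k + 1)).l) := by
    intro k
    have : (p k).l - (p (k + 1)).l = β • (A (p (k + 1)).x - (p (k + 1)).y) := by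
      simp only [hp, admmIter, admmStep]; abel
    rw [this, smul_smul, inv_mul_cancel₀ hβ.ne', one_smul, map_sub]; abel
  rw [Finset.sum_congr rfl fun k _ => e1 k, Finset.sum_add_distrib, ← Finset.smul_sum, ← map_sum,
    Finset.sum_range_sub', Finset.sum_range_sub']
  have h0 : (p 0).l = 0 := rfl
  rw [h0, zero_sub, add_comm]
  refine (norm_add_le _ _).trans (add_le_add ?_ ?_)
  · rw [norm_smul, norm_neg, norm_inv, Real.norm_eq_abs, abs_of_pos hβ, inv_mul_eq_div]
    exact div_le_div_of_nonneg_right (norm_admmIter_l_le hβ hρ hψc hψ t) hβ.le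
  · refine (A.le_opNorm _).trans (mul_le_mul_of_nonneg_left ?_ (norm_nonneg _))
    exact hD _ (admmIter_mem hΩc hΩ hc 0) _ (admmIter_mem hΩc hΩ hc t)

/-- The optimality gap of a run, for every realization of the samples. The last sum is the noise
of the stochastic subgradients. -/
lemma sadmm_gap (hΩc : IsCompact Ω) (hΩ : Convex ℝ Ω) (hc : c ∈ Ω)
    (hD : ∀ x ∈ Ω, ∀ y ∈ Ω, ‖x - y‖ ≤ D) (hη : 0 < η) (hβ : 0 < β) (hρ : 0 ≤ ρ)
    (hψc : ConvexOn ℝ Set.univ ψ) (hψ : ∀ u v, |ψ u - ψ v| ≤ ρ * ‖u - v‖)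
    (hC : (proxMatrix A a η β - ContinuousLinearMap.id ℝ _).IsPositive)
    {F : EuclideanSpace ℝ (Fin d) → ℝ} {r : ℝ} (hF : WeaklyConvexOn Ω r F)
    {gbar : EuclideanSpace ℝ (Fin d) → EuclideanSpace ℝ (Fin d)}
    (hgbar : ∀ x ∈ Ω, gbar x ∈ frechetSubdiff F x)
    {g : EuclideanSpace ℝ (Fin d) → U → EuclideanSpace ℝ (Fin d)}
    (hq : q = fun x z => g x z + r • (x - c))
    {x : EuclideanSpace ℝ (Fin d)} (hx : x ∈ Ω) {t : ℕ} (ht : 0 < t) :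
    t * (F (sadmm Ω ψ A q a η β c t ζ) + ψ (A (sadmm Ω ψ A q a η β c t ζ))
        + r / 2 * ‖sadmm Ω ψ A q a η β c t ζ - c‖ ^ 2 - (F x + ψ (A x) + r / 2 * ‖x - c‖ ^ 2))
      ≤ (a / η + β * ‖A‖ ^ 2 / 2) * ‖c - x‖ ^ 2
        + η / 4 * ∑ k ∈ Finset.range t,
          ‖q (admmIter Ω ψ A q a η β c ζ k).x (ζ (k + 1))‖ ^ 2
        + ρ * (ρ / β + ‖A‖ * D)
        + ∑ k ∈ Finset.range t, ⟪gbar (admmIter Ω ψ A q a η β c ζ k).x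
            - g (admmIter Ω ψ A q a η β c ζ k).x (ζ (k + 1)),
            (admmIter Ω ψ A q a η β c ζ k).x - x⟫ := by
  have hsum := sum_admmIter_le (q := q) (c := c) (ζ := ζ) hΩc hΩ hη hβ hψc hψ hC hx t
  have hres := norm_sum_residual_le (q := q) (ζ := ζ) (a := a) (η := η) (A := A) hΩc hΩ hc hD hβ hρ
    hψc hψ t
  have hmem := admmIter_mem (ψ := ψ) (A := A) (q := q) (a := a) (η := η) (β := β) (ζ := ζ) hΩc hΩ hc
  unfold sadmm
  set p := admmIter Ω ψ A q a η β c ζ with hp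
  set xbar := (1 / (t : ℝ)) • ∑ k ∈ Finset.range t, (p k).x with hxbar
  have htR : (0 : ℝ) < t := by exact_mod_cast ht
  have hxsum : (t : ℝ) • xbar = ∑ k ∈ Finset.range t, (p k).x := by
    rw [hxbar, smul_smul, mul_one_div_cancel htR.ne', one_smul]
  -- convexity of the smooth part together with its subgradient inequality at each iterate
  have hJ : t * (F xbar + r / 2 * ‖xbar - c‖ ^ 2)
      ≤ ∑ k ∈ Finset.range t, (F (p k).x + r / 2 * ‖(p k).x - c‖ ^ 2) := by
    have h1 := mul_average_le_sum hF ht hmem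
    rw [← hxbar] at h1
    have h2 : ∀ u : EuclideanSpace ℝ (Fin d), F u + r / 2 * ‖u - c‖ ^ 2
        = (F u + r / 2 * ‖u‖ ^ 2) + (r / 2 * ‖c‖ ^ 2 - r * ⟪u, c⟫) := by
      intro u; rw [norm_sub_sq_real]; ring
    have h3 : ∑ k ∈ Finset.range t, ⟪(p k).x, c⟫ = t * ⟪xbar, c⟫ := by
      rw [← sum_inner, ← hxsum, real_inner_smul_left]
    simp only [h2, Finset.sum_add_distrib, Finset.sum_sub_distrib, ← Finset.mul_sum,
      Finset.sum_const, Finset.card_range, nsmul_eq_mul, h3] at h1 ⊢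
    linarith
  have hsub : ∀ k, F (p k).x + r / 2 * ‖(p k).x - c‖ ^ 2 - (F x + r / 2 * ‖x - c‖ ^ 2)
      ≤ ⟪q (p k).x (ζ (k + 1)), (p k).x - x⟫
        + ⟪gbar (p k).x - g (p k).x (ζ (k + 1)), (p k).x - x⟫ := by
    intro k
    have h1 := hF.ge_of_mem_frechetSubdiff (hmem k) hx (hgbar _ (hmem k))
    rw [hq, ← inner_add_left]
    have e1 : g (p k).x (ζ (k + 1)) + r • ((p k).x - c) + (gbar (p k).x - g (p k).x (ζ (k + 1)))
        = gbar (p k).x + r • ((p k).x - c) := by abel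
    have e2 : x - c = (x - (p k).x) + ((p k).x - c) := by abel
    have e3 : (p k).x - x = - (x - (p k).x) := by abel
    rw [e1, e2, e3, inner_neg_right, inner_add_left, real_inner_smul_left, norm_add_sq_real,
      real_inner_comm ((p k).x - c) (x - (p k).x)]
    linarith
  -- convexity of the structured part, with the residual paid for by its Lipschitz constant
  have hψJ : t * ψ (A xbar) ≤ ∑ k ∈ Finset.range t, ψ (p (k + 1)).y
      + ρ * (ρ / β + ‖A‖ * D) := by
    have h1 := mul_average_le_sum hψc ht (u := fun k => (p (k + 1)).y) fun _ => Set.mem_univ _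
    set ybar := (1 / (t : ℝ)) • ∑ k ∈ Finset.range t, (p (k + 1)).y with hybar
    have h2 := (abs_le.1 (hψ (A xbar) ybar)).2
    have h3 : A xbar - ybar
        = (1 / (t : ℝ)) • ∑ k ∈ Finset.range t, (A (p k).x - (p (k + 1)).y) := by
      rw [Finset.sum_sub_distrib, smul_sub, hxbar, map_smul, map_sum]
    have h4 : t * ‖A xbar - ybar‖ ≤ ρ / β + ‖A‖ * D := by
      rw [h3, norm_smul, Real.norm_eq_abs, abs_of_pos (by positivity), ← mul_assoc,
        mul_one_div_cancel htR.ne', one_mul]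
      exact hres
    have h5 := mul_le_mul_of_nonneg_left h4 hρ
    nlinarith
  have hsub' := Finset.sum_le_sum fun k (_ : k ∈ Finset.range t) => hsub k
  simp only [Finset.sum_sub_distrib, Finset.sum_add_distrib, Finset.sum_const, Finset.card_range,
    nsmul_eq_mul] at hsub' hsum hJ ⊢
  linarith

end Run

/-! ### Measurability of the iterates -/

section Measurability

variable {d m : ℕ} {U : Type*} {Ω : Set (EuclideanSpace ℝ (Fin d))}
  {A : EuclideanSpace ℝ (Fin d) →L[ℝ] EuclideanSpace ℝ (Fin m)}
  {ψ : EuclideanSpace ℝ (Fin m) → ℝ} {a η β ρ D : ℝ}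

/-- The primal update is Lipschitz in the linear part of its objective. -/
lemma norm_updateX_sub_le (hΩc : IsCompact Ω) (hΩ : Convex ℝ Ω) (hne : Ω.Nonempty) (hη : 0 < η)
    (hβ : 0 < β) (hC : (proxMatrix A a η β - ContinuousLinearMap.id ℝ _).IsPositive)
    (v v' : EuclideanSpace ℝ (Fin d)) (p p' : ADMMState d m) :
    ‖updateX Ω A a η β v p - updateX Ω A a η β v' p'‖ ≤ η / 2 *
      ‖(v - β • ContinuousLinearMap.adjoint A (p.y + (1 / β) • p.l)
          - (2 / η) • proxMatrix A a η β p.x)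
        - (v' - β • ContinuousLinearMap.adjoint A (p'.y + (1 / β) • p'.l)
          - (2 / η) • proxMatrix A a η β p'.x)‖ := by
  obtain ⟨hz, h1⟩ := updateX_spec (A := A) (a := a) (η := η) (β := β) hΩc hΩ hne v p
  obtain ⟨hz', h2⟩ := updateX_spec (A := A) (a := a) (η := η) (β := β) hΩc hΩ hne v' p'
  replace h1 := h1 _ hz'
  replace h2 := h2 _ hz
  set z := updateX Ω A a η β v p
  set z' := updateX Ω A a η β v' p'
  have key : ∀ (v z w : EuclideanSpace ℝ (Fin d)) (p : ADMMState d m),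
      ⟪v, w⟫ + β * ⟪A z - p.y - (1 / β) • p.l, A w⟫ + 2 / η * ⟪proxMatrix A a η β (z - p.x), w⟫
        = ⟪v - β • ContinuousLinearMap.adjoint A (p.y + (1 / β) • p.l)
            - (2 / η) • proxMatrix A a η β p.x, w⟫
          + β * ⟪A z, A w⟫ + 2 / η * ⟪proxMatrix A a η β z, w⟫ := by
    intro v z w p
    simp only [map_sub, inner_sub_left, real_inner_smul_left,
      ContinuousLinearMap.adjoint_inner_left, inner_add_left]
    ring
  rw [key] at h1 h2
  set b := v - β • ContinuousLinearMap.adjoint A (p.y + (1 / β) • p.l)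
    - (2 / η) • proxMatrix A a η β p.x
  set b' := v' - β • ContinuousLinearMap.adjoint A (p'.y + (1 / β) • p'.l)
    - (2 / η) • proxMatrix A a η β p'.x
  have e : z - z' = - (z' - z) := by abel
  have h3 : 0 ≤ ⟪b - b', z' - z⟫ - β * ⟪A (z' - z), A (z' - z)⟫
      - 2 / η * ⟪proxMatrix A a η β (z' - z), z' - z⟫ := by
    rw [e, map_neg, inner_neg_right, inner_neg_right, inner_neg_right] at h2
    rw [inner_sub_left, map_sub (proxMatrix A a η β), inner_sub_left (proxMatrix A a η β z'),
      map_sub A, inner_sub_left (A z'), ← map_sub A]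
    linarith
  rw [real_inner_self_eq_norm_sq, real_inner_comm (z' - z) (proxMatrix A a η β _)] at h3
  have h4 := norm_sq_le_inner_proxMatrix hC (z' - z)
  have h5 := real_inner_le_norm (b - b') (z' - z)
  have h6 : 0 ≤ β * ‖A (z' - z)‖ ^ 2 := by positivity
  have h7 : 2 / η * ‖z' - z‖ ^ 2 ≤ 2 / η * ⟪z' - z, proxMatrix A a η β (z' - z)⟫ :=
    mul_le_mul_of_nonneg_left h4 (by positivity)
  have h8 : 2 / η * ‖z' - z‖ ^ 2 ≤ ‖b - b'‖ * ‖z' - z‖ := by linarith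
  rw [norm_sub_rev z z']
  rcases (norm_nonneg (z' - z)).eq_or_lt with h0 | h0
  · rw [← h0]; positivity
  · have h9 : 2 / η * ‖z' - z‖ ≤ ‖b - b'‖ := by
      refine le_of_mul_le_mul_right ?_ h0
      linarith
    rw [div_mul_eq_mul_div, div_le_iff₀ hη] at h9
    linarith

lemma continuous_updateX (hΩc : IsCompact Ω) (hΩ : Convex ℝ Ω) (hne : Ω.Nonempty) (hη : 0 < η)
    (hβ : 0 < β) (hC : (proxMatrix A a η β - ContinuousLinearMap.id ℝ _).IsPositive) :
    Continuous (fun w : EuclideanSpace ℝ (Fin d) × EuclideanSpace ℝ (Fin d)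
      × EuclideanSpace ℝ (Fin m) × EuclideanSpace ℝ (Fin m) =>
        updateX Ω A a η β w.1 ⟨w.2.1, w.2.2.1, w.2.2.2⟩) := by
  set b : EuclideanSpace ℝ (Fin d) × EuclideanSpace ℝ (Fin d)
      × EuclideanSpace ℝ (Fin m) × EuclideanSpace ℝ (Fin m) → EuclideanSpace ℝ (Fin d) :=
    fun w => w.1 - β • ContinuousLinearMap.adjoint A (w.2.2.1 + (1 / β) • w.2.2.2)
      - (2 / η) • proxMatrix A a η β w.2.1 with hb
  have hbc : Continuous b := by fun_prop
  refine continuous_iff_continuousAt.2 fun w₀ => ?_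
  refine tendsto_iff_norm_sub_tendsto_zero.2 ?_
  have h1 : Filter.Tendsto (fun w => η / 2 * ‖b w - b w₀‖) (𝓝 w₀) (𝓝 0) := by
    have : Continuous fun w => η / 2 * ‖b w - b w₀‖ := by fun_prop
    simpa using this.tendsto w₀
  exact squeeze_zero (fun _ => norm_nonneg _)
    (fun w => norm_updateX_sub_le hΩc hΩ hne hη hβ hC w.1 w₀.1 _ _) h1

lemma continuous_updateY (hβ : 0 < β) (hψc : ConvexOn ℝ Set.univ ψ)
    (hψ : ∀ u v, |ψ u - ψ v| ≤ ρ * ‖u - v‖) :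
    Continuous (fun w : EuclideanSpace ℝ (Fin d) × EuclideanSpace ℝ (Fin m) =>
      updateY ψ A β w.1 w.2) := by
  have hw : WeaklyConvexOn Set.univ 0 ψ := by simpa [WeaklyConvexOn] using hψc
  simp only [updateY_eq_prox]
  exact (continuous_prox convex_univ hβ hβ.le hw
    (exists_isMinOn_prox_of_lipschitz hβ hψ)).comp (by fun_prop)

lemma measurable_admmStep {W : Type*} [MeasurableSpace W] (hΩc : IsCompact Ω) (hΩ : Convex ℝ Ω)
    (hne : Ω.Nonempty) (hη : 0 < η) (hβ : 0 < β) (hψc : ConvexOn ℝ Set.univ ψ)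
    (hψ : ∀ u v, |ψ u - ψ v| ≤ ρ * ‖u - v‖)
    (hC : (proxMatrix A a η β - ContinuousLinearMap.id ℝ _).IsPositive)
    {v : W → EuclideanSpace ℝ (Fin d)} {p : W → ADMMState d m} (hv : Measurable v)
    (h1 : Measurable fun ω => (p ω).x) (h2 : Measurable fun ω => (p ω).y)
    (h3 : Measurable fun ω => (p ω).l) :
    Measurable (fun ω => (admmStep Ω ψ A a η β (v ω) (p ω)).x) ∧
    Measurable (fun ω => (admmStep Ω ψ A a η β (v ω) (p ω)).y) ∧
    Measurable (fun ω => (admmStep Ω ψ A a η β (v ω) (p ω)).l) := by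
  have hc := (continuous_updateX hΩc hΩ hne hη hβ hC).measurable
  have hx : Measurable fun ω => updateX Ω A a η β (v ω) ⟨(p ω).x, (p ω).y, (p ω).l⟩ := by
    have h4 := hc.comp (hv.prodMk (h1.prodMk (h2.prodMk h3)))
    simpa only [Function.comp_def] using h4
  have hy := (continuous_updateY (A := A) hβ hψc hψ).measurable.comp (hx.prodMk h3)
  exact ⟨hx, hy, h3.sub (((A.continuous.measurable.comp hx).sub hy).const_smul β)⟩

/-- The iterates of a stage with random center `c` are adapted. -/
lemma measurable_admmIter [MeasurableSpace U] {W : Type*} (hΩc : IsCompact Ω) (hΩ : Convex ℝ Ω)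
    (hne : Ω.Nonempty) (hη : 0 < η) (hβ : 0 < β) (hψc : ConvexOn ℝ Set.univ ψ)
    (hψ : ∀ u v, |ψ u - ψ v| ≤ ρ * ‖u - v‖)
    (hC : (proxMatrix A a η β - ContinuousLinearMap.id ℝ _).IsPositive)
    {g : EuclideanSpace ℝ (Fin d) → U → EuclideanSpace ℝ (Fin d)}
    (hg : Measurable (Function.uncurry g)) (r : ℝ) {𝓕 : ℕ → MeasurableSpace W} (hmono : Monotone 𝓕)
    {c : W → EuclideanSpace ℝ (Fin d)} (hc : Measurable[𝓕 0] c) {ζ : ℕ → W → U}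
    (hζ : ∀ k, Measurable[𝓕 k] (ζ k)) (k : ℕ) :
    Measurable[𝓕 k] (fun ω => (admmIter Ω ψ A (fun x z => g x z + r • (x - c ω)) a η β (c ω)
      (fun j => ζ j ω) k).x) ∧
    Measurable[𝓕 k] (fun ω => (admmIter Ω ψ A (fun x z => g x z + r • (x - c ω)) a η β (c ω)
      (fun j => ζ j ω) k).y) ∧
    Measurable[𝓕 k] (fun ω => (admmIter Ω ψ A (fun x z => g x z + r • (x - c ω)) a η β (c ω)
      (fun j => ζ j ω) k).l) := by
  induction k with
  | zero => exact ⟨hc, A.continuous.measurable.comp hc, measurable_const⟩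
  | succ k ih =>
    obtain ⟨h1, h2, h3⟩ := ih
    have hle := hmono (Nat.le_succ k)
    replace h1 := h1.mono hle le_rfl
    replace h2 := h2.mono hle le_rfl
    replace h3 := h3.mono hle le_rfl
    have hc' := hc.mono (hmono (Nat.zero_le (k + 1))) le_rfl
    have hζ' := hζ (k + 1)
    let _ : MeasurableSpace W := 𝓕 (k + 1)
    exact measurable_admmStep hΩc hΩ hne hη hβ hψc hψ hC
      ((hg.comp (h1.prodMk hζ')).add ((h1.sub hc').const_smul r)) h1 h2 h3

end Measurability

/-! ### Expectations over a fresh sample -/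

section Noise

lemma integrable_comp_of_isCompact {E W : Type*} [NormedAddCommGroup E] [MeasurableSpace E]
    [BorelSpace E] {mW : MeasurableSpace W} {Pr : Measure W} [IsProbabilityMeasure Pr] {Ω : Set E}
    {φ : E → ℝ} (hΩc : IsCompact Ω) (hφ : ContinuousOn φ Ω)
    {X : W → E} (hX : Measurable X) (hXΩ : ∀ ω, X ω ∈ Ω) : Integrable (fun ω => φ (X ω)) Pr := by
  classical
  obtain ⟨M, hM⟩ := hΩc.exists_bound_of_continuousOn hφ
  have h1 : Measurable (Ω.piecewise φ fun _ => (0 : ℝ)) :=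
    hφ.measurable_piecewise continuousOn_const hΩc.measurableSet
  have h2 : (fun ω => φ (X ω)) = fun ω => Ω.piecewise φ (fun _ => (0 : ℝ)) (X ω) := by
    funext ω; rw [Set.piecewise_eq_of_mem _ _ _ (hXΩ ω)]
  refine Integrable.of_bound (C := M) ?_ (ae_of_all _ fun ω => hM _ (hXΩ ω))
  rw [h2]
  exact (h1.comp hX).aestronglyMeasurable

/-- A crude bound of the mean subgradient; only its uniformity in `x` matters below. -/
lemma norm_integral_le_of_sq {E U : Type*} [NormedAddCommGroup E] [NormedSpace ℝ E]
    [MeasurableSpace U] {P : Measure U} [IsProbabilityMeasure P] {g : E → U → E} {G : ℝ} {x : E}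
    (hg2 : MemLp (g x) 2 P)
    (hG : ∫ z, ‖g x z‖ ^ 2 ∂P ≤ G ^ 2) : ‖∫ z, g x z ∂P‖ ≤ 1 + G ^ 2 := by
  have hsq : Integrable (fun z => ‖g x z‖ ^ 2) P := hg2.integrable_norm_pow two_ne_zero
  have hn : Integrable (fun z => ‖g x z‖) P := (hg2.integrable one_le_two).norm
  calc ‖∫ z, g x z ∂P‖ ≤ ∫ z, ‖g x z‖ ∂P := norm_integral_le_integral_norm _
    _ ≤ ∫ z, (1 + ‖g x z‖ ^ 2) ∂P :=
        integral_mono hn ((integrable_const _).add hsq) fun z => by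
          dsimp only; nlinarith [sq_nonneg (‖g x z‖ - 1)]
    _ = 1 + ∫ z, ‖g x z‖ ^ 2 ∂P := by
        rw [integral_add (integrable_const _) hsq]; simp
    _ ≤ 1 + G ^ 2 := by linarith

/-- The joint law of a quantity from the past and a fresh sample is a product. -/
lemma map_prodMk_of_indep {U V W : Type*} [MeasurableSpace U] [MeasurableSpace V]
    {m mW : MeasurableSpace W} {P : Measure U} {Pr : Measure W} [IsProbabilityMeasure Pr]
    {Y : W → V} {ζ : W → U} (hm : m ≤ mW)
    (hY : Measurable[m] Y) (hζ : Measurable ζ)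
    (hlaw : Measure.map ζ Pr = P) (hind : Indep m (MeasurableSpace.comap ζ inferInstance) Pr) :
    Measure.map (fun ω => (Y ω, ζ ω)) Pr = (Measure.map Y Pr).prod P := by
  have h1 : IndepFun Y ζ Pr :=
    (IndepFun_iff_Indep _ _ _).2 (indep_of_indep_of_le_left hind hY.comap_le)
  rw [(indepFun_iff_map_prod_eq_prod_map_map (hY.mono hm le_rfl).aemeasurable
    hζ.aemeasurable).1 h1, hlaw]

/-- The second moment of the stochastic subgradient at a point independent of the sample. -/
lemma integral_norm_sq_subgradient {E U W : Type*} [NormedAddCommGroup E] [MeasurableSpace E]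
    [BorelSpace E] [MeasurableSpace U] {m mW : MeasurableSpace W} {P : Measure U}
    [IsProbabilityMeasure P] {Pr : Measure W} [IsProbabilityMeasure Pr] {Ω : Set E} {g : E → U → E}
    {G : ℝ} {X : W → E} {ζ : W → U} (hΩ : MeasurableSet Ω) (hg : Measurable (Function.uncurry g))
    (hg2 : ∀ x ∈ Ω, MemLp (g x) 2 P) (hG : ∀ x ∈ Ω, ∫ z, ‖g x z‖ ^ 2 ∂P ≤ G ^ 2) (hm : m ≤ mW)
    (hX : Measurable[m] X) (hXΩ : ∀ ω, X ω ∈ Ω) (hζ : Measurable ζ)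
    (hlaw : Measure.map ζ Pr = P) (hind : Indep m (MeasurableSpace.comap ζ inferInstance) Pr) :
    Integrable (fun ω => ‖g (X ω) (ζ ω)‖ ^ 2) Pr ∧ ∫ ω, ‖g (X ω) (ζ ω)‖ ^ 2 ∂Pr ≤ G ^ 2 := by
  have hX' : Measurable X := hX.mono hm le_rfl
  have hmap := map_prodMk_of_indep hm hX hζ hlaw hind
  have hpair : AEMeasurable (fun ω => (X ω, ζ ω)) Pr := (hX'.prodMk hζ).aemeasurable
  have : IsProbabilityMeasure (Measure.map X Pr) :=
    Measure.isProbabilityMeasure_map hX'.aemeasurable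
  have hae : ∀ᵐ x ∂(Measure.map X Pr), x ∈ Ω := by
    exact (ae_map_iff hX'.aemeasurable hΩ).2 (ae_of_all _ hXΩ)
  have hH : Measurable fun p : E × U => ‖g p.1 p.2‖ ^ 2 := (hg.norm).pow_const 2
  have hint : Integrable (fun p : E × U => ‖g p.1 p.2‖ ^ 2) ((Measure.map X Pr).prod P) := by
    rw [integrable_prod_iff hH.aestronglyMeasurable]
    refine ⟨?_, ?_⟩
    · filter_upwards [hae] with x hx
      exact (hg2 x hx).integrable_norm_pow two_ne_zero
    · refine Integrable.of_bound (C := G ^ 2)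
        (hH.norm.stronglyMeasurable.integral_prod_right').aestronglyMeasurable ?_
      filter_upwards [hae] with x hx
      rw [Real.norm_of_nonneg (integral_nonneg fun _ => norm_nonneg _)]
      simpa using hG x hx
  have hint' := hint
  rw [← hmap, integrable_map_measure hH.aestronglyMeasurable hpair] at hint'
  refine ⟨hint', ?_⟩
  have h1 := integral_map hpair (f := fun p : E × U => ‖g p.1 p.2‖ ^ 2) hH.aestronglyMeasurable
  rw [← h1, hmap, integral_prod _ hint]
  calc ∫ x, ∫ z, ‖g x z‖ ^ 2 ∂P ∂(Measure.map X Pr) ≤ ∫ _, G ^ 2 ∂(Measure.map X Pr) := by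
        refine integral_mono_ae hint.integral_prod_left (integrable_const _) ?_
        filter_upwards [hae] with x hx using hG x hx
    _ = G ^ 2 := by simp

variable {E : Type*} [NormedAddCommGroup E] [InnerProductSpace ℝ E] [FiniteDimensional ℝ E]
  [MeasurableSpace E] [BorelSpace E] {U W : Type*} [MeasurableSpace U]
  {m : MeasurableSpace W} {mW : MeasurableSpace W}
  {P : Measure U} [IsProbabilityMeasure P] {Pr : Measure W} [IsProbabilityMeasure Pr]
  {Ω : Set E} {g : E → U → E} {G D : ℝ}

variable {X Z : W → E} {ζ : W → U}

/-- The error of the stochastic subgradient is centered, given the past. -/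
lemma integral_noise_eq_zero (hΩ : MeasurableSet Ω) (hD : ∀ x ∈ Ω, ∀ y ∈ Ω, ‖x - y‖ ≤ D)
    (hg : Measurable (Function.uncurry g))
    (hg2 : ∀ x ∈ Ω, MemLp (g x) 2 P) (hG : ∀ x ∈ Ω, ∫ z, ‖g x z‖ ^ 2 ∂P ≤ G ^ 2) (hm : m ≤ mW)
    (hX : Measurable[m] X) (hXΩ : ∀ ω, X ω ∈ Ω) (hZ : Measurable[m] Z) (hZΩ : ∀ ω, Z ω ∈ Ω)
    (hζ : Measurable ζ) (hlaw : Measure.map ζ Pr = P)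
    (hind : Indep m (MeasurableSpace.comap ζ inferInstance) Pr) :
    Integrable (fun ω => ⟪(∫ z, g (X ω) z ∂P) - g (X ω) (ζ ω), X ω - Z ω⟫) Pr ∧
      ∫ ω, ⟪(∫ z, g (X ω) z ∂P) - g (X ω) (ζ ω), X ω - Z ω⟫ ∂Pr = 0 := by
  obtain ⟨hsq, -⟩ := integral_norm_sq_subgradient hΩ hg hg2 hG hm hX hXΩ hζ hlaw hind
  have hX' : Measurable X := hX.mono hm le_rfl
  have hZ' : Measurable Z := hZ.mono hm le_rfl
  have hmap := map_prodMk_of_indep hm (Y := fun ω => (X ω, Z ω)) (hX.prodMk hZ) hζ hlaw hind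
  have hXZ : Measurable fun ω => (X ω, Z ω) := hX'.prodMk hZ'
  have hpair : AEMeasurable (fun ω => ((X ω, Z ω), ζ ω)) Pr := (hXZ.prodMk hζ).aemeasurable
  have hgbar : Measurable fun x => ∫ z, g x z ∂P :=
    (hg.stronglyMeasurable.integral_prod_right').measurable
  have hK : Measurable fun p : (E × E) × U => ⟪g p.1.1 p.2, p.1.1 - p.1.2⟫ :=
    (hg.comp ((measurable_fst.comp measurable_fst).prodMk measurable_snd)).inner (by fun_prop)
  have hL : Measurable fun p : E × E => ⟪∫ z, g p.1 z ∂P, p.1 - p.2⟫ :=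
    (hgbar.comp measurable_fst).inner (by fun_prop)
  have hint1 : Integrable (fun ω => ⟪g (X ω) (ζ ω), X ω - Z ω⟫) Pr := by
    refine Integrable.mono' (((integrable_const 1).add hsq).mul_const D)
      (hK.comp (hXZ.prodMk hζ)).aestronglyMeasurable (ae_of_all _ fun ω => ?_)
    refine (abs_real_inner_le_norm _ _).trans ?_
    refine mul_le_mul ?_ (hD _ (hXΩ ω) _ (hZΩ ω)) (norm_nonneg _) ?_
    · simp only [Pi.add_apply]; nlinarith [sq_nonneg (‖g (X ω) (ζ ω)‖ - 1)]
    · simp only [Pi.add_apply]; positivity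
  have hint2 : Integrable (fun ω => ⟪∫ z, g (X ω) z ∂P, X ω - Z ω⟫) Pr := by
    refine Integrable.of_bound (C := (1 + G ^ 2) * D) (hL.comp hXZ).aestronglyMeasurable
      (ae_of_all _ fun ω => ?_)
    refine (abs_real_inner_le_norm _ _).trans ?_
    exact mul_le_mul (norm_integral_le_of_sq (hg2 _ (hXΩ ω)) (hG _ (hXΩ ω)))
      (hD _ (hXΩ ω) _ (hZΩ ω)) (norm_nonneg _) (by positivity)
  have hae : ∀ᵐ p ∂(Measure.map (fun ω => (X ω, Z ω)) Pr), p.1 ∈ Ω := by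
    exact (ae_map_iff hXZ.aemeasurable (measurable_fst hΩ)).2 (ae_of_all _ hXΩ)
  have heq : ∫ ω, ⟪g (X ω) (ζ ω), X ω - Z ω⟫ ∂Pr
      = ∫ ω, ⟪∫ z, g (X ω) z ∂P, X ω - Z ω⟫ ∂Pr := by
    have : IsProbabilityMeasure (Measure.map (fun ω => (X ω, Z ω)) Pr) :=
      Measure.isProbabilityMeasure_map hXZ.aemeasurable
    have h1 := integral_map hpair (f := fun p : (E × E) × U => ⟪g p.1.1 p.2, p.1.1 - p.1.2⟫)
      hK.aestronglyMeasurable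
    have h2 := integral_map (hXZ.aemeasurable (μ := Pr))
      (f := fun p : E × E => ⟪∫ z, g p.1 z ∂P, p.1 - p.2⟫) hL.aestronglyMeasurable
    have h3 : Integrable (fun p : (E × E) × U => ⟪g p.1.1 p.2, p.1.1 - p.1.2⟫)
        ((Measure.map (fun ω => (X ω, Z ω)) Pr).prod P) := by
      rw [← hmap, integrable_map_measure hK.aestronglyMeasurable hpair]
      exact hint1
    rw [← h1, ← h2, hmap, integral_prod _ h3]
    refine integral_congr_ae ?_
    filter_upwards [hae] with p hp
    have h4 := integral_inner ((hg2 _ hp).integrable one_le_two) (𝕜 := ℝ) (p.1 - p.2)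
    simp only [real_inner_comm (p.1 - p.2)] at h4 ⊢
    exact h4
  simp only [inner_sub_left (∫ z, g _ z ∂P)]
  refine ⟨hint2.sub hint1, ?_⟩
  rw [integral_sub hint2 hint1, heq, sub_self]

end Noise

/-! ### Expected progress of a stage -/

section Stage

variable {d m : ℕ} {U W : Type*} [MeasurableSpace U] {mW : MeasurableSpace W}
  {P : Measure U} [IsProbabilityMeasure P] {Pr : Measure W} [IsProbabilityMeasure Pr]
  {Ω : Set (EuclideanSpace ℝ (Fin d))}
  {A : EuclideanSpace ℝ (Fin d) →L[ℝ] EuclideanSpace ℝ (Fin m)}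
  {ψ : EuclideanSpace ℝ (Fin m) → ℝ} {a η β ρ D G : ℝ}

/-- Expected decrease of the objective along a stage with random center `c`, in terms of the
distance of `c` to its proximal point. -/
lemma integral_sadmm_le (hΩc : IsCompact Ω) (hΩ : Convex ℝ Ω) (hne : Ω.Nonempty)
    (hD : ∀ x ∈ Ω, ∀ y ∈ Ω, ‖x - y‖ ≤ D) (hη : 0 < η) (hβ : 0 < β) (hρ : 0 ≤ ρ)
    (hψc : ConvexOn ℝ Set.univ ψ) (hψ : ∀ u v, |ψ u - ψ v| ≤ ρ * ‖u - v‖)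
    (hC : (proxMatrix A a η β - ContinuousLinearMap.id ℝ _).IsPositive)
    {F : EuclideanSpace ℝ (Fin d) → ℝ} {μ r : ℝ} (hr : 0 ≤ r) (hμr : μ < r)
    (hF : WeaklyConvexOn Ω r F) (hφ : WeaklyConvexOn Ω μ (fun x => F x + ψ (A x)))
    (hφc : ContinuousOn (fun x => F x + ψ (A x)) Ω)
    {g : EuclideanSpace ℝ (Fin d) → U → EuclideanSpace ℝ (Fin d)}
    (hg : Measurable (Function.uncurry g))
    (hgF : ∀ x ∈ Ω, ∫ z, g x z ∂P ∈ frechetSubdiff F x)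
    (hg2 : ∀ x ∈ Ω, MemLp (g x) 2 P) (hG : ∀ x ∈ Ω, ∫ z, ‖g x z‖ ^ 2 ∂P ≤ G ^ 2)
    {𝓕 : ℕ → MeasurableSpace W} (hmono : Monotone 𝓕) (hle : ∀ k, 𝓕 k ≤ mW)
    {c : W → EuclideanSpace ℝ (Fin d)} (hc : Measurable[𝓕 0] c) (hcΩ : ∀ ω, c ω ∈ Ω)
    {ζ : ℕ → W → U} (hζ : ∀ k, Measurable[𝓕 k] (ζ k)) (hlaw : ∀ k, Measure.map (ζ k) Pr = P)
    (hind : ∀ k, Indep (𝓕 k) (MeasurableSpace.comap (ζ (k + 1)) inferInstance) Pr)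
    {t : ℕ} (ht : 0 < t) :
    Measurable[𝓕 t] (fun ω => sadmm Ω ψ A (fun x z => g x z + r • (x - c ω)) a η β (c ω) t
      (fun j => ζ j ω)) ∧
    t * (∫ ω, (F (sadmm Ω ψ A (fun x z => g x z + r • (x - c ω)) a η β (c ω) t (fun j => ζ j ω))
          + ψ (A (sadmm Ω ψ A (fun x z => g x z + r • (x - c ω)) a η β (c ω) t
            (fun j => ζ j ω)))) ∂Pr
        - ∫ ω, (F (c ω) + ψ (A (c ω))) ∂Pr
        + (r - μ) / 2 * ∫ ω, ‖c ω - prox Ω (fun x => F x + ψ (A x)) r⁻¹ (c ω)‖ ^ 2 ∂Pr)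
      ≤ (a / η + β * ‖A‖ ^ 2 / 2)
          * ∫ ω, ‖c ω - prox Ω (fun x => F x + ψ (A x)) r⁻¹ (c ω)‖ ^ 2 ∂Pr
        + η / 4 * (t * (2 * G ^ 2 + 2 * (r * D) ^ 2)) + ρ * (ρ / β + ‖A‖ * D) := by
  set φ : EuclideanSpace ℝ (Fin d) → ℝ := fun x => F x + ψ (A x) with hφdef
  have hex := exists_isMinOn_prox_of_isCompact hΩc hne hφc r
  have hproxc : Continuous (prox Ω φ r⁻¹) := continuous_prox hΩ hμr hr hφ hex
  set z : W → EuclideanSpace ℝ (Fin d) := fun ω => prox Ω φ r⁻¹ (c ω) with hz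
  have hzm : Measurable[𝓕 0] z := hproxc.measurable.comp hc
  have hzΩ : ∀ ω, z ω ∈ Ω := fun ω => (prox_spec (hex (c ω))).1
  set u : ℕ → W → EuclideanSpace ℝ (Fin d) := fun k ω =>
    (admmIter Ω ψ A (fun x z => g x z + r • (x - c ω)) a η β (c ω) (fun j => ζ j ω) k).x with hu
  have hum : ∀ k, Measurable[𝓕 k] (u k) := fun k =>
    (measurable_admmIter hΩc hΩ hne hη hβ hψc hψ hC hg r hmono hc hζ k).1
  have huΩ : ∀ k ω, u k ω ∈ Ω := fun k ω => admmIter_mem hΩc hΩ (hcΩ ω) k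
  set xbar : W → EuclideanSpace ℝ (Fin d) := fun ω =>
    sadmm Ω ψ A (fun x z => g x z + r • (x - c ω)) a η β (c ω) t (fun j => ζ j ω) with hxbar
  have hxbarΩ : ∀ ω, xbar ω ∈ Ω := fun ω => sadmm_mem hΩc hΩ (hcΩ ω) ht
  have hxm : Measurable[𝓕 t] xbar := by
    let _ : MeasurableSpace W := 𝓕 t
    have h1 : Measurable fun ω => (1 / (t : ℝ)) • ∑ k ∈ Finset.range t, u k ω :=
      (Finset.measurable_fun_sum (Finset.range t) fun k hk =>
        (hum k).mono (hmono (Finset.mem_range.1 hk).le) le_rfl).const_smul (1 / (t : ℝ))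
    exact h1
  refine ⟨hxm, ?_⟩
  have hΩm : MeasurableSet Ω := hΩc.measurableSet
  have hsq := fun k => integral_norm_sq_subgradient hΩm hg hg2 hG (hle k) (hum k) (huΩ k)
    ((hζ (k + 1)).mono (hle _) le_rfl) (hlaw (k + 1)) (hind k)
  have hnoise := fun k => integral_noise_eq_zero hΩm hD hg hg2 hG (hle k) (hum k) (huΩ k)
    (hzm.mono (hmono (Nat.zero_le k)) le_rfl) hzΩ ((hζ (k + 1)).mono (hle _) le_rfl)
    (hlaw (k + 1)) (hind k)
  -- the inequality for every realization
  have hpath : ∀ ω, t * (φ (xbar ω) - φ (c ω) + (r - μ) / 2 * ‖c ω - z ω‖ ^ 2)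
      ≤ ((a / η + β * ‖A‖ ^ 2 / 2) * ‖c ω - z ω‖ ^ 2
        + η / 4 * ∑ k ∈ Finset.range t, (2 * ‖g (u k ω) (ζ (k + 1) ω)‖ ^ 2 + 2 * (r * D) ^ 2)
        + ρ * (ρ / β + ‖A‖ * D))
        + ∑ k ∈ Finset.range t,
          ⟪(∫ y, g (u k ω) y ∂P) - g (u k ω) (ζ (k + 1) ω), u k ω - z ω⟫ := by
    intro ω
    have h1 := sadmm_gap (g := g) (ζ := fun j => ζ j ω) hΩc hΩ (hcΩ ω) hD hη hβ hρ hψc hψ hC hF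
      hgF rfl (hzΩ ω) ht
    have h2 := hφ.growth hΩ (hzΩ ω) (hcΩ ω) (prox_spec (hex (c ω))).2
    have h3 : ∀ k, ‖g (u k ω) (ζ (k + 1) ω) + r • (u k ω - c ω)‖ ^ 2
        ≤ 2 * ‖g (u k ω) (ζ (k + 1) ω)‖ ^ 2 + 2 * (r * D) ^ 2 := by
      intro k
      have h4 := norm_add_le (g (u k ω) (ζ (k + 1) ω)) (r • (u k ω - c ω))
      have h5 : ‖r • (u k ω - c ω)‖ ≤ r * D := by
        rw [norm_smul, Real.norm_of_nonneg hr]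
        exact mul_le_mul_of_nonneg_left (hD _ (huΩ k ω) _ (hcΩ ω)) hr
      have h6 : ‖g (u k ω) (ζ (k + 1) ω) + r • (u k ω - c ω)‖
          ≤ ‖g (u k ω) (ζ (k + 1) ω)‖ + r * D := h4.trans (by linarith)
      have h7 := pow_le_pow_left₀ (norm_nonneg _) h6 2
      nlinarith [sq_nonneg (‖g (u k ω) (ζ (k + 1) ω)‖ - r * D)]
    have h8 := mul_le_mul_of_nonneg_left (Finset.sum_le_sum fun k (_ : k ∈ Finset.range t) => h3 k)
      (by positivity : 0 ≤ η / 4)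
    have h9 : (t : ℝ) * (φ (xbar ω) - φ (c ω) + (r - μ) / 2 * ‖c ω - z ω‖ ^ 2)
        ≤ t * (φ (xbar ω) + r / 2 * ‖xbar ω - c ω‖ ^ 2
          - (φ (z ω) + r / 2 * ‖z ω - c ω‖ ^ 2)) := by
      refine mul_le_mul_of_nonneg_left ?_ (by positivity)
      have h10 : 0 ≤ r / 2 * ‖xbar ω - c ω‖ ^ 2 := by positivity
      simp only [sub_self, norm_zero, zero_pow two_ne_zero, mul_zero, add_zero] at h2
      linarith
    refine h9.trans (h1.trans ?_)
    simp only [hu, hz] at h8 ⊢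
    linarith
  have hcm := hc.mono (hle 0) le_rfl
  have hi1 : Integrable (fun ω => φ (xbar ω)) Pr :=
    integrable_comp_of_isCompact hΩc hφc (hxm.mono (hle t) le_rfl) hxbarΩ
  have hi2 : Integrable (fun ω => φ (c ω)) Pr := integrable_comp_of_isCompact hΩc hφc hcm hcΩ
  have hi3 : Integrable (fun ω => ‖c ω - z ω‖ ^ 2) Pr :=
    integrable_comp_of_isCompact (φ := fun x => ‖x - prox Ω φ r⁻¹ x‖ ^ 2) hΩc
      (by fun_prop) hcm hcΩ
  have hi4 : ∀ k, Integrable (fun ω => 2 * ‖g (u k ω) (ζ (k + 1) ω)‖ ^ 2 + 2 * (r * D) ^ 2) Pr :=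
    fun k => ((hsq k).1.const_mul 2).add (integrable_const _)
  have hi5 := integrable_finsetSum (Finset.range t) fun k _ => hi4 k
  have hi6 := integrable_finsetSum (Finset.range t) fun k _ => (hnoise k).1
  have hi7 : Integrable (fun ω => (a / η + β * ‖A‖ ^ 2 / 2) * ‖c ω - z ω‖ ^ 2
      + η / 4 * ∑ k ∈ Finset.range t, (2 * ‖g (u k ω) (ζ (k + 1) ω)‖ ^ 2 + 2 * (r * D) ^ 2)) Pr :=
    (hi3.const_mul _).add (hi5.const_mul _)
  have hi8 : Integrable (fun ω => (a / η + β * ‖A‖ ^ 2 / 2) * ‖c ω - z ω‖ ^ 2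
      + η / 4 * ∑ k ∈ Finset.range t, (2 * ‖g (u k ω) (ζ (k + 1) ω)‖ ^ 2 + 2 * (r * D) ^ 2)
      + ρ * (ρ / β + ‖A‖ * D)) Pr := hi7.add (integrable_const _)
  have hi9 : Integrable (fun ω => φ (xbar ω) - φ (c ω)) Pr := hi1.sub hi2
  have hi10 : Integrable (fun ω => φ (xbar ω) - φ (c ω) + (r - μ) / 2 * ‖c ω - z ω‖ ^ 2) Pr :=
    hi9.add (hi3.const_mul _)
  have hint := integral_mono (hi10.const_mul (t : ℝ)) (hi8.add hi6) hpath
  simp only [Pi.add_apply] at hint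
  rw [integral_const_mul, integral_add hi9 (hi3.const_mul _), integral_const_mul,
    integral_sub hi1 hi2, integral_add hi8 hi6, integral_add hi7 (integrable_const _),
    integral_add (hi3.const_mul _) (hi5.const_mul _), integral_const_mul, integral_const_mul,
    integral_finsetSum _ fun k _ => hi4 k, integral_finsetSum _ fun k _ => (hnoise k).1,
    Finset.sum_eq_zero fun k _ => (hnoise k).2] at hint
  have hsum : ∑ k ∈ Finset.range t,
      ∫ ω, (2 * ‖g (u k ω) (ζ (k + 1) ω)‖ ^ 2 + 2 * (r * D) ^ 2) ∂Pr
        ≤ t * (2 * G ^ 2 + 2 * (r * D) ^ 2) := by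
    have : ∀ k ∈ Finset.range t,
        ∫ ω, (2 * ‖g (u k ω) (ζ (k + 1) ω)‖ ^ 2 + 2 * (r * D) ^ 2) ∂Pr
          ≤ 2 * G ^ 2 + 2 * (r * D) ^ 2 := by
      intro k _
      rw [integral_add ((hsq k).1.const_mul 2) (integrable_const _), integral_const_mul]
      have := (hsq k).2
      simp only [integral_const, probReal_univ, one_smul]
      linarith
    exact (Finset.sum_le_sum this).trans_eq
      (by rw [Finset.sum_const, Finset.card_range, nsmul_eq_mul])
  have hsum' := mul_le_mul_of_nonneg_left hsum (by positivity : 0 ≤ η / 4)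
  simp only [integral_const, probReal_univ, one_smul] at hint
  linarith

end Stage

/-! ### Step sizes and weights -/

lemma one_le_of_proxMatrix {d m : ℕ}
    {A : EuclideanSpace ℝ (Fin d) →L[ℝ] EuclideanSpace ℝ (Fin m)} {a η β : ℝ} (hη : 0 < η)
    (hβ : 0 < β) (hC : (proxMatrix A a η β - ContinuousLinearMap.id ℝ _).IsPositive)
    (hA : ‖A‖ ≠ 0) : 1 ≤ a := by
  have hA' : A ≠ 0 := fun h => hA (by rw [h, norm_zero])
  obtain ⟨u, hu⟩ : ∃ u, A u ≠ 0 := by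
    by_contra! h
    exact hA' (ContinuousLinearMap.ext h)
  have hu0 : 0 < ‖u‖ ^ 2 := by
    have : u ≠ 0 := fun h => hu (by rw [h, map_zero])
    positivity
  have h1 := (norm_sq_le_inner_proxMatrix hC u).trans (inner_proxMatrix_le hη hβ u)
  by_contra! h
  nlinarith

/-- With the prescribed step sizes and number of iterations, a stage decreases the objective up to
an error of order `1 / s`. The factor `N = ‖A‖` vanishes when `a` is allowed to be small. -/
lemma stage_arithmetic {c₁ c₂ ρ G D N μ a s T E₁ E₀ e : ℝ} (hc₁ : 0 < c₁) (hc₂ : 0 < c₂)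
    (hρ : 0 ≤ ρ) (hD : 0 < D) (hN : 0 ≤ N) (hμ : 0 < μ) (ha : 0 < a) (haN : N ≠ 0 → 1 ≤ a)
    (hs : 0 < s) (hT1 : 1 ≤ T)
    (hT : 24 * s * (1 / (2 * μ)) * max (a / c₁) (c₂ * N ^ 2) ≤ T) (he : 0 ≤ e)
    (h : T * (E₁ - E₀ + (2 * μ - μ) / 2 * e) ≤ (a / (c₁ / s) + c₂ * s * N ^ 2 / 2) * e
        + c₁ / s / 4 * (T * (2 * G ^ 2 + 2 * (2 * μ * D) ^ 2)) + ρ * (ρ / (c₂ * s) + N * D)) :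
    E₁ ≤ E₀ - 3 * μ / 8 * e
      + (c₁ / 4 * (2 * G ^ 2 + 2 * (2 * μ * D) ^ 2) + ρ ^ 2 / c₂ + ρ * N * D * c₁ * μ / 12)
        / s := by
  have hT0 : 0 < T := by linarith
  have hT' : 12 * s * max (a / c₁) (c₂ * N ^ 2) ≤ μ * T := by
    have : 24 * s * (1 / (2 * μ)) * max (a / c₁) (c₂ * N ^ 2)
        = 12 * s * max (a / c₁) (c₂ * N ^ 2) / μ := by field_simp; ring
    rw [this, div_le_iff₀ hμ] at hT
    linarith
  have hTa : 12 * s * (a / c₁) ≤ μ * T :=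
    (mul_le_mul_of_nonneg_left (le_max_left _ _) (by positivity)).trans hT'
  have hTN : 12 * s * (c₂ * N ^ 2) ≤ μ * T :=
    (mul_le_mul_of_nonneg_left (le_max_right _ _) (by positivity)).trans hT'
  have h1 : (a / (c₁ / s) + c₂ * s * N ^ 2 / 2) * e ≤ T * (μ / 8 * e) := by
    rw [← mul_assoc]
    refine mul_le_mul_of_nonneg_right ?_ he
    have : a / (c₁ / s) = s * (a / c₁) := by field_simp
    rw [this]
    linarith
  have h2 : ρ * (ρ / (c₂ * s)) ≤ T * (ρ ^ 2 / c₂ / s) := by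
    have h3 : ρ * (ρ / (c₂ * s)) = ρ ^ 2 / c₂ / s := by field_simp
    rw [h3]
    exact le_mul_of_one_le_left (by positivity) hT1
  have h4 : ρ * (N * D) ≤ T * (ρ * N * D * c₁ * μ / 12 / s) := by
    rcases eq_or_ne N 0 with h0 | h0
    · rw [h0]; simp
    · have ha1 := haN h0
      have h5 : 12 * s ≤ c₁ * μ * T := by
        have h6 : 12 * s * (a / c₁) = 12 * s * a / c₁ := by ring
        rw [h6, div_le_iff₀ hc₁] at hTa
        nlinarith
      have h7 : T * (ρ * N * D * c₁ * μ / 12 / s) = (ρ * (N * D)) * (c₁ * μ * T / (12 * s)) := by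
        field_simp
      rw [h7]
      exact le_mul_of_one_le_right (by positivity) ((one_le_div (by positivity)).2 h5)
  have h8 : c₁ / s / 4 * (T * (2 * G ^ 2 + 2 * (2 * μ * D) ^ 2))
      = T * (c₁ / 4 * (2 * G ^ 2 + 2 * (2 * μ * D) ^ 2) / s) := by ring
  have h9 : T * (E₁ - E₀ + (2 * μ - μ) / 2 * e) ≤ T * (μ / 8 * e
      + c₁ / 4 * (2 * G ^ 2 + 2 * (2 * μ * D) ^ 2) / s + ρ ^ 2 / c₂ / s
      + ρ * N * D * c₁ * μ / 12 / s) := by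
    linarith
  have h10 := le_of_mul_le_mul_left h9 hT0
  rw [add_div, add_div]
  linarith

/-- `∫₀ⁿ x ^ α ≤ ∑ k ≤ n, k ^ α`, by Bernoulli's inequality. -/
lemma rpow_le_sum_weights {α : ℝ} (hα : 0 < α) (n : ℕ) :
    (n : ℝ) ^ (α + 1) / (α + 1) ≤ ∑ k ∈ Finset.range n, ((k : ℝ) + 1) ^ α := by
  induction n with
  | zero => simp [Real.zero_rpow (by linarith : α + 1 ≠ 0)]
  | succ n ih =>
    rw [Finset.sum_range_succ]
    have hn : (0 : ℝ) < n + 1 := by positivity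
    have h1 := one_add_mul_self_le_rpow_one_add (s := -1 / ((n : ℝ) + 1)) (p := α + 1)
      (by rw [le_div_iff₀ hn]; nlinarith [Nat.cast_nonneg (α := ℝ) n]) (by linarith)
    have e1 : 1 + -1 / ((n : ℝ) + 1) = n / (n + 1) := by field_simp; ring
    rw [e1, Real.div_rpow (by positivity) hn.le, le_div_iff₀ (by positivity)] at h1
    have e2 : (1 + (α + 1) * (-1 / ((n : ℝ) + 1))) * ((n : ℝ) + 1) ^ (α + 1)
        = ((n : ℝ) + 1) ^ (α + 1) - (α + 1) * ((n : ℝ) + 1) ^ α := by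
      rw [Real.rpow_add hn, Real.rpow_one]; field_simp; ring
    rw [e2] at h1
    rw [div_le_iff₀ (by linarith)] at ih ⊢
    push_cast
    linarith

/-- `∑ k ≤ n, k ^ (α - 1)` is at most `n ^ α`, or `∫₀ⁿ x ^ (α - 1)` when `α < 1`. -/
lemma sum_rpow_sub_one_le {α : ℝ} (hα : 0 < α) (n : ℕ) :
    ∑ k ∈ Finset.range n, ((k : ℝ) + 1) ^ (α - 1)
      ≤ (n : ℝ) ^ α / α ^ (if α < 1 then 1 else 0 : ℕ) := by
  split_ifs with h
  · rw [pow_one]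
    induction n with
    | zero => simp [Real.zero_rpow hα.ne']
    | succ n ih =>
      rw [Finset.sum_range_succ]
      have hn : (0 : ℝ) < n + 1 := by positivity
      have h1 := rpow_one_add_le_one_add_mul_self (s := -1 / ((n : ℝ) + 1)) (p := α)
        (by rw [le_div_iff₀ hn]; nlinarith [Nat.cast_nonneg (α := ℝ) n]) hα.le h.le
      have e1 : 1 + -1 / ((n : ℝ) + 1) = n / (n + 1) := by field_simp; ring
      rw [e1, Real.div_rpow (by positivity) hn.le, div_le_iff₀ (by positivity)] at h1
      have e2 : (1 + α * (-1 / ((n : ℝ) + 1))) * ((n : ℝ) + 1) ^ α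
          = ((n : ℝ) + 1) ^ α - α * ((n : ℝ) + 1) ^ (α - 1) := by
        rw [Real.rpow_sub hn, Real.rpow_one]; field_simp; ring
      rw [e2] at h1
      rw [le_div_iff₀ hα] at ih ⊢
      push_cast
      linarith
  · rw [pow_zero, div_one]
    push Not at h
    rcases Nat.eq_zero_or_pos n with rfl | hn
    · simp [Real.zero_rpow hα.ne']
    · have h1 : ∀ k ∈ Finset.range n, ((k : ℝ) + 1) ^ (α - 1) ≤ (n : ℝ) ^ (α - 1) := by
        intro k hk
        refine Real.rpow_le_rpow (by positivity) ?_ (by linarith)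
        exact_mod_cast Finset.mem_range.1 hk
      refine (Finset.sum_le_sum h1).trans (le_of_eq ?_)
      have hn' : (0 : ℝ) < n := by exact_mod_cast hn
      rw [Finset.sum_const, Finset.card_range, nsmul_eq_mul, Real.rpow_sub hn', Real.rpow_one]
      field_simp

/-- Summation by parts for increasing weights, with all increments of `b` at most `Δ`. -/
lemma sum_weighted_diff_le {α Δ : ℝ} (hα : 0 < α) {S : ℕ} {b : ℕ → ℝ}
    (hb : ∀ i ≤ S, b i - b S ≤ Δ) :
    ∑ k ∈ Finset.range S, ((k : ℝ) + 1) ^ α * (b k - b (k + 1)) ≤ (S : ℝ) ^ α * Δ := by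
  have key : ∀ n ≤ S, ∑ k ∈ Finset.range n, ((k : ℝ) + 1) ^ α * (b k - b (k + 1))
      ≤ (n : ℝ) ^ α * (Δ - (b n - b S)) := by
    intro n
    induction n with
    | zero => intro _; simp [Real.zero_rpow hα.ne']
    | succ n ih =>
      intro hn
      rw [Finset.sum_range_succ]
      have h1 := ih (by omega)
      have h2 : (n : ℝ) ^ α ≤ ((n : ℝ) + 1) ^ α :=
        Real.rpow_le_rpow (by positivity) (by linarith) hα.le
      have h3 := mul_le_mul_of_nonneg_right h2 (sub_nonneg.2 (hb n (by omega)))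
      push_cast
      linarith
  simpa using key S le_rfl

/-- The weighted average of the squared gradients `4 μ² e k`. The first `S` of them contribute
`4 μ² · 8 / (3 μ) = 32 μ / 3` times the decrease of the objective, and the last one contributes
`4 μ² · 2 / (3 μ) = 8 μ / 3` times `Δ`; the sum of the two factors is below `16 μ`. -/
lemma weighted_average_le {α Δ μ K : ℝ} (hα : 0 < α) (hΔ : 0 < Δ) (hμ : 0 < μ) (hK : 0 ≤ K)
    {S : ℕ} {b e : ℕ → ℝ} (hb : ∀ i ≤ S, b i - b S ≤ Δ)
    (hstep : ∀ s < S, b (s + 1) ≤ b s - 3 * μ / 8 * e s + K / ((s : ℝ) + 1))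
    (hlast : 3 * μ / 2 * e S ≤ Δ) :
    ∑ k ∈ Finset.range (S + 1), ((k : ℝ) + 1) ^ α
        / (∑ j ∈ Finset.range (S + 1), ((j : ℝ) + 1) ^ α) * ((2 * μ) ^ 2 * e k)
      ≤ 16 * μ * Δ * (α + 1) / ((S : ℝ) + 1)
        + 32 / 3 * μ * K * (α + 1) / (((S : ℝ) + 1) * α ^ (if α < 1 then 1 else 0 : ℕ)) := by
  set i : ℕ := if α < 1 then 1 else 0 with hi
  set w := ∑ j ∈ Finset.range (S + 1), ((j : ℝ) + 1) ^ α with hw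
  have hS : (0 : ℝ) < S + 1 := by positivity
  have hw1 : ((S : ℝ) + 1) ^ α * (S + 1) ≤ (α + 1) * w := by
    have h1 := rpow_le_sum_weights hα (S + 1)
    rw [div_le_iff₀ (by linarith)] at h1
    push_cast at h1
    rw [Real.rpow_add hS, Real.rpow_one] at h1
    linarith
  have hw0 : 0 < w := Finset.sum_pos (fun _ _ => by positivity) ⟨0, by simp⟩
  have hmono : (S : ℝ) ^ α ≤ ((S : ℝ) + 1) ^ α :=
    Real.rpow_le_rpow (by positivity) (by linarith) hα.le
  have h1 : ∑ k ∈ Finset.range S, ((k : ℝ) + 1) ^ α * (3 * μ / 8 * e k)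
      ≤ (S : ℝ) ^ α * Δ + K * ((S : ℝ) ^ α / α ^ i) := by
    have h2 : ∀ k ∈ Finset.range S, ((k : ℝ) + 1) ^ α * (3 * μ / 8 * e k)
        ≤ ((k : ℝ) + 1) ^ α * (b k - b (k + 1)) + K * ((k : ℝ) + 1) ^ (α - 1) := by
      intro k hk
      have h3 := hstep k (Finset.mem_range.1 hk)
      have hk : (0 : ℝ) < k + 1 := by positivity
      have h4 : K * ((k : ℝ) + 1) ^ (α - 1) = ((k : ℝ) + 1) ^ α * (K / ((k : ℝ) + 1)) := by
        rw [Real.rpow_sub hk, Real.rpow_one]; ring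
      rw [h4, ← mul_add]
      exact mul_le_mul_of_nonneg_left (by linarith) (by positivity)
    refine (Finset.sum_le_sum h2).trans ?_
    rw [Finset.sum_add_distrib, ← Finset.mul_sum]
    exact add_le_add (sum_weighted_diff_le hα hb)
      (mul_le_mul_of_nonneg_left (sum_rpow_sub_one_le hα S) hK)
  have hai : 0 < α ^ i := by positivity
  have h5 : K * ((S : ℝ) ^ α / α ^ i) ≤ K * (((S : ℝ) + 1) ^ α / α ^ i) :=
    mul_le_mul_of_nonneg_left (div_le_div_of_nonneg_right hmono hai.le) hK
  have h6 := mul_le_mul_of_nonneg_right hmono hΔ.le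
  have h7 : ∑ k ∈ Finset.range (S + 1), ((k : ℝ) + 1) ^ α * ((2 * μ) ^ 2 * e k)
      ≤ ((S : ℝ) + 1) ^ α * (16 * μ * Δ + 32 / 3 * μ * K / α ^ i) := by
    rw [Finset.sum_range_succ]
    have h8 : ∑ k ∈ Finset.range S, ((k : ℝ) + 1) ^ α * ((2 * μ) ^ 2 * e k)
        = 32 / 3 * μ * ∑ k ∈ Finset.range S, ((k : ℝ) + 1) ^ α * (3 * μ / 8 * e k) := by
      rw [Finset.mul_sum]
      exact Finset.sum_congr rfl fun _ _ => by ring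
    have h9 : ((S : ℝ) + 1) ^ α * ((2 * μ) ^ 2 * e S) ≤ 8 / 3 * μ * (((S : ℝ) + 1) ^ α * Δ) := by
      have h10 := mul_le_mul_of_nonneg_left hlast
        (by positivity : 0 ≤ 8 / 3 * μ * ((S : ℝ) + 1) ^ α)
      linarith
    have h11 := mul_le_mul_of_nonneg_left (h1.trans (add_le_add h6 h5))
      (by positivity : 0 ≤ 32 / 3 * μ)
    have h12 : 0 ≤ μ * (((S : ℝ) + 1) ^ α * Δ) := by positivity
    have h13 : ((S : ℝ) + 1) ^ α * (16 * μ * Δ + 32 / 3 * μ * K / α ^ i)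
        = 16 * (μ * (((S : ℝ) + 1) ^ α * Δ))
          + 32 / 3 * μ * (K * (((S : ℝ) + 1) ^ α / α ^ i)) := by ring
    rw [h8, h13]
    linarith
  have h14 : ∑ k ∈ Finset.range (S + 1), ((k : ℝ) + 1) ^ α / w * ((2 * μ) ^ 2 * e k)
      = (∑ k ∈ Finset.range (S + 1), ((k : ℝ) + 1) ^ α * ((2 * μ) ^ 2 * e k)) / w := by
    rw [Finset.sum_div]
    exact Finset.sum_congr rfl fun _ _ => by ring
  have h15 : 16 * μ * Δ * (α + 1) / ((S : ℝ) + 1)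
        + 32 / 3 * μ * K * (α + 1) / (((S : ℝ) + 1) * α ^ i)
      = (α + 1) / (S + 1) * (16 * μ * Δ + 32 / 3 * μ * K / α ^ i) := by
    field_simp
  rw [h14, h15, div_le_iff₀ hw0]
  refine h7.trans ?_
  have h16 : ((S : ℝ) + 1) ^ α ≤ (α + 1) / (S + 1) * w := by
    rw [div_mul_eq_mul_div, le_div_iff₀ hS]
    exact hw1
  have h17 := mul_le_mul_of_nonneg_right h16
    (by positivity : 0 ≤ 16 * μ * Δ + 32 / 3 * μ * K / α ^ i)
  linarith

/-! ### The random output index -/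

/-- The expectation of `Y τ` for a random index `τ` that is independent of the sequence `Y`. -/
lemma integral_random_index {W : Type*} {m mW : MeasurableSpace W} {Pr : Measure W}
    [IsProbabilityMeasure Pr] {n : ℕ} {τ : W → Fin n} (hτ : Measurable τ)
    (hm : m ≤ mW) (hind : Indep (MeasurableSpace.comap τ inferInstance) m Pr)
    {Y : ℕ → W → ℝ} (hY : ∀ k < n, Measurable[m] (Y k)) (hYi : ∀ k < n, Integrable (Y k) Pr) :
    Integrable (fun ω => Y (τ ω) ω) Pr ∧
      ∫ ω, Y (τ ω) ω ∂Pr = ∑ k : Fin n, (Pr (τ ⁻¹' {k})).toReal * ∫ ω, Y k ω ∂Pr := by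
  have hset : ∀ k, MeasurableSet (τ ⁻¹' {k}) := fun k => hτ (measurableSet_singleton k)
  have e : (fun ω => Y (τ ω) ω)
      = fun ω => ∑ k : Fin n, (τ ⁻¹' {k}).indicator (fun _ => (1 : ℝ)) ω * Y k ω := by
    funext ω
    rw [Finset.sum_eq_single (τ ω)]
    · simp
    · intro k _ hk
      rw [Set.indicator_of_notMem (by simpa using hk.symm), zero_mul]
    · simp
  have hprod : ∀ k : Fin n,
      Integrable (fun ω => (τ ⁻¹' {k}).indicator (fun _ => (1 : ℝ)) ω * Y k ω) Pr := by
    intro k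
    have : (fun ω => (τ ⁻¹' {k}).indicator (fun _ => (1 : ℝ)) ω * Y k ω)
        = (τ ⁻¹' {k}).indicator (Y k) := by
      funext ω
      by_cases h : ω ∈ τ ⁻¹' {k} <;> simp [h]
    rw [this]
    exact (hYi k k.2).indicator (hset k)
  rw [e]
  refine ⟨integrable_finsetSum _ fun k _ => hprod k, ?_⟩
  rw [integral_finsetSum _ fun k _ => hprod k]
  refine Finset.sum_congr rfl fun k _ => ?_
  have hf : IndepFun τ (Y k) Pr :=
    (IndepFun_iff_Indep _ _ _).2 (indep_of_indep_of_le_right hind (hY k k.2).comap_le)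
  have hk : Measurable (({k} : Set (Fin n)).indicator fun _ => (1 : ℝ)) :=
    measurable_const.indicator (measurableSet_singleton k)
  have hf' := hf.comp (φ := ({k} : Set (Fin n)).indicator fun _ => (1 : ℝ)) (ψ := id)
    hk measurable_id
  have h1 := hf'.integral_fun_mul_eq_mul_integral
    (hk.comp hτ).aestronglyMeasurable
    ((hY k k.2).mono hm le_rfl).aestronglyMeasurable
  have h2 : ∫ ω, (τ ⁻¹' {k}).indicator (fun _ => (1 : ℝ)) ω ∂Pr = (Pr (τ ⁻¹' {k})).toReal := by
    rw [integral_indicator_const _ (hset k)]; simp [Measure.real]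
  rw [← h2]
  exact h1

/-! ### The sequence of stages -/

section Stages

variable {d m : ℕ} {U W : Type*} [MeasurableSpace U] {mW : MeasurableSpace W}
  {P : Measure U} {Pr : Measure W}
  {Ω : Set (EuclideanSpace ℝ (Fin d))}
  {A : EuclideanSpace ℝ (Fin d) →L[ℝ] EuclideanSpace ℝ (Fin m)}
  {ψ : EuclideanSpace ℝ (Fin m) → ℝ} {a ρ D G : ℝ}

/-- The information carried by the samples with index in `I`. -/
abbrev sampleInfo (ξ : ℕ → ℕ → W → U) (I : Set (ℕ × ℕ)) : MeasurableSpace W :=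
  ⨆ p ∈ I, MeasurableSpace.comap (ξ p.1 p.2) inferInstance

lemma sampleInfo_mono (ξ : ℕ → ℕ → W → U) {I J : Set (ℕ × ℕ)} (h : I ⊆ J) :
    sampleInfo ξ I ≤ sampleInfo ξ J :=
  biSup_mono h

lemma sampleInfo_le {ξ : ℕ → ℕ → W → U} (hξ : ∀ s t, Measurable (ξ s t)) (I : Set (ℕ × ℕ)) :
    sampleInfo ξ I ≤ mW :=
  iSup₂_le fun p _ => (hξ p.1 p.2).comap_le

lemma measurable_sampleInfo (ξ : ℕ → ℕ → W → U) {I : Set (ℕ × ℕ)} {p : ℕ × ℕ} (hp : p ∈ I) :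
    Measurable[sampleInfo ξ I] (ξ p.1 p.2) :=
  measurable_iff_comap_le.2
    (le_biSup (fun p : ℕ × ℕ => MeasurableSpace.comap (ξ p.1 p.2) inferInstance) hp)

lemma indep_sampleInfo {ξ : ℕ → ℕ → W → U} (hξ : ∀ s t, Measurable (ξ s t))
    (hind : iIndepFun (fun p : ℕ × ℕ => ξ p.1 p.2) Pr) {I : Set (ℕ × ℕ)} {p : ℕ × ℕ}
    (hp : p ∉ I) :
    Indep (sampleInfo ξ I) (MeasurableSpace.comap (ξ p.1 p.2) inferInstance) Pr := by
  have h1 := indep_iSup_of_disjoint (fun q : ℕ × ℕ => (hξ q.1 q.2).comap_le) hind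
    (Set.disjoint_singleton_right.2 hp)
  simpa [sampleInfo] using h1

/-- Along the stages, the iterates stay feasible, depend only on the samples of the stages so far,
and satisfy the expected decrease of `integral_sadmm_le`. -/
lemma stagewise_spec [IsProbabilityMeasure P] [IsProbabilityMeasure Pr]
    (hΩc : IsCompact Ω) (hΩ : Convex ℝ Ω)
    (hD : ∀ x ∈ Ω, ∀ y ∈ Ω, ‖x - y‖ ≤ D) {η β : ℕ → ℝ} {S : ℕ}
    (hη : ∀ s ∈ Finset.Icc 1 S, 0 < η s) (hβ : ∀ s ∈ Finset.Icc 1 S, 0 < β s) (hρ : 0 ≤ ρ)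
    (hψc : ConvexOn ℝ Set.univ ψ) (hψ : ∀ u v, |ψ u - ψ v| ≤ ρ * ‖u - v‖)
    (hC : ∀ s ∈ Finset.Icc 1 S,
      (proxMatrix A a (η s) (β s) - ContinuousLinearMap.id ℝ _).IsPositive)
    {F : EuclideanSpace ℝ (Fin d) → ℝ} {μ γ : ℝ} (hγ : 0 ≤ γ⁻¹) (hμγ : μ < γ⁻¹)
    (hF : WeaklyConvexOn Ω γ⁻¹ F) (hφ : WeaklyConvexOn Ω μ (fun x => F x + ψ (A x)))
    (hφc : ContinuousOn (fun x => F x + ψ (A x)) Ω)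
    {g : EuclideanSpace ℝ (Fin d) → U → EuclideanSpace ℝ (Fin d)}
    (hg : Measurable (Function.uncurry g))
    (hgF : ∀ x ∈ Ω, ∫ z, g x z ∂P ∈ frechetSubdiff F x)
    (hg2 : ∀ x ∈ Ω, MemLp (g x) 2 P) (hG : ∀ x ∈ Ω, ∫ z, ‖g x z‖ ^ 2 ∂P ≤ G ^ 2)
    {T : ℕ → ℕ} (hT : ∀ s ∈ Finset.Icc 1 S, 0 < T s)
    {ξ : ℕ → ℕ → W → U} (hξ : ∀ s t, Measurable (ξ s t))
    (hlaw : ∀ s t, Measure.map (ξ s t) Pr = P)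
    (hind : iIndepFun (fun p : ℕ × ℕ => ξ p.1 p.2) Pr)
    {x₀ : EuclideanSpace ℝ (Fin d)} (hx₀ : x₀ ∈ Ω) {X : ℕ → W → EuclideanSpace ℝ (Fin d)}
    (hX : X = fun s ω => stagewise Ω ψ A g γ a η β T x₀ (fun s t => ξ s t ω) s) (s : ℕ)
    (hs : s ≤ S) :
    Measurable[sampleInfo ξ {p | p.1 ≤ s}] (X s) ∧ (∀ ω, X s ω ∈ Ω) ∧
    (s < S → (T (s + 1) : ℝ) * (∫ ω, (F (X (s + 1) ω) + ψ (A (X (s + 1) ω))) ∂Pr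
        - ∫ ω, (F (X s ω) + ψ (A (X s ω))) ∂Pr
        + (γ⁻¹ - μ) / 2 * ∫ ω, ‖X s ω - prox Ω (fun x => F x + ψ (A x)) γ (X s ω)‖ ^ 2 ∂Pr)
      ≤ (a / η (s + 1) + β (s + 1) * ‖A‖ ^ 2 / 2)
          * ∫ ω, ‖X s ω - prox Ω (fun x => F x + ψ (A x)) γ (X s ω)‖ ^ 2 ∂Pr
        + η (s + 1) / 4 * (T (s + 1) * (2 * G ^ 2 + 2 * (γ⁻¹ * D) ^ 2))
        + ρ * (ρ / β (s + 1) + ‖A‖ * D)) := by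
  have hstage : ∀ s < S, Measurable[sampleInfo ξ {p | p.1 ≤ s}] (X s) → (∀ ω, X s ω ∈ Ω) →
      Measurable[sampleInfo ξ {p | p.1 ≤ s + 1}] (X (s + 1)) ∧
      (T (s + 1) : ℝ) * (∫ ω, (F (X (s + 1) ω) + ψ (A (X (s + 1) ω))) ∂Pr
        - ∫ ω, (F (X s ω) + ψ (A (X s ω))) ∂Pr
        + (γ⁻¹ - μ) / 2 * ∫ ω, ‖X s ω - prox Ω (fun x => F x + ψ (A x)) γ (X s ω)‖ ^ 2 ∂Pr)
      ≤ (a / η (s + 1) + β (s + 1) * ‖A‖ ^ 2 / 2)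
          * ∫ ω, ‖X s ω - prox Ω (fun x => F x + ψ (A x)) γ (X s ω)‖ ^ 2 ∂Pr
        + η (s + 1) / 4 * (T (s + 1) * (2 * G ^ 2 + 2 * (γ⁻¹ * D) ^ 2))
        + ρ * (ρ / β (s + 1) + ‖A‖ * D) := by
    intro s hs hm hmem
    have hs' : s + 1 ∈ Finset.Icc 1 S := Finset.mem_Icc.2 ⟨by omega, hs⟩
    -- what is known before sample `k + 1` of stage `s + 1` is drawn
    set I : ℕ → Set (ℕ × ℕ) := fun k => {p | p.1 ≤ s ∨ (p.1 = s + 1 ∧ p.2 ≤ k)} with hI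
    have h1 := integral_sadmm_le (𝓕 := fun k => sampleInfo ξ (I k)) (ζ := ξ (s + 1)) (c := X s)
      (a := a) (Pr := Pr) hΩc hΩ ⟨x₀, hx₀⟩ hD (hη _ hs') (hβ _ hs') hρ hψc hψ (hC _ hs') hγ hμγ hF
      hφ hφc hg hgF hg2 hG
      (fun i j hij => sampleInfo_mono ξ fun p hp => hp.imp_right fun h => ⟨h.1, h.2.trans hij⟩)
      (fun k => sampleInfo_le hξ _)
      (hm.mono (sampleInfo_mono ξ fun p hp => Or.inl hp) le_rfl) hmem
      (fun k => measurable_sampleInfo ξ (p := (s + 1, k)) (Or.inr ⟨rfl, le_rfl⟩))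
      (fun k => hlaw _ _)
      (fun k => indep_sampleInfo hξ hind (p := (s + 1, k + 1)) (by simp [hI])) (hT _ hs')
    have e : X (s + 1) = fun ω => sadmm Ω ψ A (fun x z => g x z + γ⁻¹ • (x - X s ω)) a
        (η (s + 1)) (β (s + 1)) (X s ω) (T (s + 1)) (fun j => ξ (s + 1) j ω) := by
      rw [hX]; rfl
    rw [← e, inv_inv] at h1
    refine ⟨h1.1.mono (sampleInfo_mono ξ ?_) le_rfl, ?_⟩
    · rintro p (hp | hp)
      · exact Nat.le_succ_of_le hp
      · exact hp.1.le
    · rw [e] at h1 ⊢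
      exact h1.2
  have hbase : ∀ s ≤ S, Measurable[sampleInfo ξ {p | p.1 ≤ s}] (X s) ∧ ∀ ω, X s ω ∈ Ω := by
    intro s
    induction s with
    | zero =>
      intro _
      have e : X 0 = fun _ => x₀ := by rw [hX]; rfl
      rw [e]
      exact ⟨measurable_const, fun _ => hx₀⟩
    | succ s ih =>
      intro hs
      obtain ⟨h1, h2⟩ := ih (by omega)
      refine ⟨(hstage s hs h1 h2).1, fun ω => ?_⟩
      rw [hX] at h2 ⊢
      exact sadmm_mem hΩc hΩ (h2 ω) (hT _ (Finset.mem_Icc.2 ⟨by omega, hs⟩))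
  obtain ⟨h1, h2⟩ := hbase s hs
  exact ⟨h1, h2, fun h => (hstage s h h1 h2).2⟩

end Stages

end StagewiseADMM

theorem theorem5
    (c₁ c₂ ρ G D N μ : ℝ) (hc₁ : 0 < c₁) (hc₂ : 0 < c₂) (hρ : 0 ≤ ρ) (hG : 0 ≤ G) (hD : 0 < D)
    (hμ : 0 < μ) :
    -- the constant depends on `c₁, c₂, ρ, G, D, ‖A‖ = N` and `μ` only
    ∃ C : ℝ,
      ∀ (d m : ℕ) (U : Type*) [MeasurableSpace U] (P : Measure U) [IsProbabilityMeasure P]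
        (Ω : Set (EuclideanSpace ℝ (Fin d)))
        (A : EuclideanSpace ℝ (Fin d) →L[ℝ] EuclideanSpace ℝ (Fin m))
        (ψ : EuclideanSpace ℝ (Fin m) → ℝ)
        (f : EuclideanSpace ℝ (Fin d) → U → ℝ)
        (g : EuclideanSpace ℝ (Fin d) → U → EuclideanSpace ℝ (Fin d))
        (Δ γ α a : ℝ) (S : ℕ) (T : ℕ → ℕ) (x₀ : EuclideanSpace ℝ (Fin d)),
        -- the domain is closed, convex and bounded by `D`, and contains the starting point
        IsClosed Ω → Convex ℝ Ω → (∀ x ∈ Ω, ∀ y ∈ Ω, ‖x - y‖ ≤ D) → x₀ ∈ Ω →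
        -- the structured regularizer
        ‖A‖ = N → ConvexOn ℝ Set.univ ψ → (∀ u v, |ψ u - ψ v| ≤ ρ * ‖u - v‖) →
        -- the expected loss exists and has a stochastic subgradient with bounded second moment
        (∀ x, Integrable (f x) P) →
        Measurable (Function.uncurry g) →
        (∀ x ∈ Ω, MemLp (g x) 2 P) →
        (∀ x ∈ Ω, ∫ z, g x z ∂P ∈ StagewiseADMM.frechetSubdiff (StagewiseADMM.expectedLoss P f) x) →
        (∀ x ∈ Ω, ∫ z, ‖g x z‖ ^ 2 ∂P ≤ G ^ 2) →
        -- the objective is `μ`-weakly convex and varies by at most `Δ` over the domain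
        StagewiseADMM.WeaklyConvexOn Ω μ (StagewiseADMM.objective P f ψ A) →
        0 < Δ →
        (∀ x ∈ Ω, ∀ z ∈ Ω,
          StagewiseADMM.objective P f ψ A x - StagewiseADMM.objective P f ψ A z ≤ Δ) →
        -- the expected loss is convex once the quadratic term of a stage is added to it
        γ = 1 / (2 * μ) →
        StagewiseADMM.WeaklyConvexOn Ω γ⁻¹ (StagewiseADMM.expectedLoss P f) →
        -- the parameters
        0 < α → 0 < a →
        (∀ s ∈ Finset.Icc 1 S,
          (StagewiseADMM.proxMatrix A a (c₁ / (s : ℝ)) (c₂ * (s : ℝ))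
            - ContinuousLinearMap.id ℝ (EuclideanSpace ℝ (Fin d))).IsPositive) →
        (∀ s ∈ Finset.Icc 1 S, 24 * (s : ℝ) * γ * max (a / c₁) (c₂ * ‖A‖ ^ 2) ≤ (T s : ℝ)) →
        -- independent samples `ξ s t` with law `P`, and an independent random index `τ`
        ∀ (W : Type*) [MeasurableSpace W] (Pr : Measure W) [IsProbabilityMeasure Pr]
          (ξ : ℕ → ℕ → W → U) (τ : W → Fin (S + 1)),
          (∀ s t, Measurable (ξ s t)) →
          (∀ s t, Measure.map (ξ s t) Pr = P) →
          iIndepFun (fun p : ℕ × ℕ => ξ p.1 p.2) Pr →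
          Measurable τ →
          (∀ k : Fin (S + 1), Pr (τ ⁻¹' {k}) =
            ENNReal.ofReal (((k : ℕ) + 1 : ℝ) ^ α / ∑ j : Fin (S + 1), ((j : ℕ) + 1 : ℝ) ^ α)) →
          IndepFun τ (fun ω (p : ℕ × ℕ) => ξ p.1 p.2 ω) Pr →
          Integrable (fun ω =>
            ‖StagewiseADMM.moreauGrad Ω (StagewiseADMM.objective P f ψ A) γ
              (StagewiseADMM.stagewise Ω ψ A g γ a (fun s => c₁ / (s : ℝ)) (fun s => c₂ * (s : ℝ)) T
                x₀ (fun s t => ξ s t ω) (τ ω : ℕ))‖ ^ 2) Pr ∧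
          ∫ ω, ‖StagewiseADMM.moreauGrad Ω (StagewiseADMM.objective P f ψ A) γ
              (StagewiseADMM.stagewise Ω ψ A g γ a (fun s => c₁ / (s : ℝ)) (fun s => c₂ * (s : ℝ)) T
                x₀ (fun s t => ξ s t ω) (τ ω : ℕ))‖ ^ 2 ∂Pr
            ≤ 16 * μ * Δ * (α + 1) / ((S : ℝ) + 1)
              + C * (α + 1) / (((S : ℝ) + 1) * α ^ (if α < 1 then 1 else 0 : ℕ)) := by
  -- `32 / 3 * μ` times the error of a stage, which is the sum of a variance term, of the bound for
  -- the multipliers and of the displacement of the iterates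
  refine ⟨32 / 3 * μ * (c₁ / 4 * (2 * G ^ 2 + 2 * (2 * μ * D) ^ 2) + ρ ^ 2 / c₂
    + ρ * N * D * c₁ * μ / 12), ?_⟩
  intro d m U _ P _ Ω A ψ f g Δ γ α a S T x₀ hΩcl hΩ hdiam hx₀ hAN hψc hψ _ hg hg2 hgF hG hφ hΔ hφΔ
    hγ hF hα ha hC hT W _ Pr _ ξ τ hξ hlaw hind hτ hprob hτind
  set F := StagewiseADMM.expectedLoss P f with hFdef
  set φ := StagewiseADMM.objective P f ψ A with hφdef
  have hφF : φ = fun x => F x + ψ (A x) := rfl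
  have hγinv : γ⁻¹ = 2 * μ := by rw [hγ]; simp
  have hN : 0 ≤ N := hAN ▸ norm_nonneg A
  have hΩc : IsCompact Ω := by
    refine Metric.isCompact_of_isClosed_isBounded hΩcl ?_
    exact Metric.isBounded_iff.2 ⟨D, fun x hx y hy => by rw [dist_eq_norm]; exact hdiam x hx y hy⟩
  have hψcont : Continuous ψ := by
    refine (LipschitzWith.of_dist_le_mul (K := ⟨ρ, hρ⟩) fun u v => ?_).continuous
    rw [Real.dist_eq, dist_eq_norm]
    exact hψ u v
  have hFc : ContinuousOn F Ω := hF.continuousOn_of_subgradient (by rw [hγinv]; positivity)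
    hdiam hgF fun x hx => StagewiseADMM.norm_integral_le_of_sq (hg2 x hx) (hG x hx)
  have hφc : ContinuousOn φ Ω := hFc.add (hψcont.comp A.continuous).continuousOn
  have hex := StagewiseADMM.exists_isMinOn_prox_of_isCompact hΩc ⟨x₀, hx₀⟩ hφc γ⁻¹
  have hproxc : Continuous (StagewiseADMM.prox Ω φ γ) := by
    have := StagewiseADMM.continuous_prox hΩ (r := γ⁻¹) (by rw [hγinv]; linarith)
      (by rw [hγinv]; positivity) hφ hex
    rwa [inv_inv] at this
  have hspos : ∀ s ∈ Finset.Icc 1 S, (0 : ℝ) < s := fun s hs => by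
    exact_mod_cast (Finset.mem_Icc.1 hs).1
  have hTpos : ∀ s ∈ Finset.Icc 1 S, 0 < T s := by
    intro s hs
    have h1 := hT s hs
    have h2 : 0 < 24 * (s : ℝ) * γ * max (a / c₁) (c₂ * ‖A‖ ^ 2) := by
      have h3 := hspos s hs
      have h4 : 0 < γ := by rw [hγ]; positivity
      have h5 : 0 < max (a / c₁) (c₂ * ‖A‖ ^ 2) := lt_max_of_lt_left (by positivity)
      positivity
    exact_mod_cast h2.trans_le h1
  obtain ⟨X, hX⟩ : ∃ X : ℕ → W → EuclideanSpace ℝ (Fin d), X = fun s ω =>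
      StagewiseADMM.stagewise Ω ψ A g γ a (fun s => c₁ / (s : ℝ)) (fun s => c₂ * (s : ℝ)) T
        x₀ (fun s t => ξ s t ω) s := ⟨_, rfl⟩
  have hspec := StagewiseADMM.stagewise_spec hΩc hΩ hdiam
    (fun s hs => div_pos hc₁ (hspos s hs)) (fun s hs => mul_pos hc₂ (hspos s hs)) hρ hψc hψ hC
    (by rw [hγinv]; positivity) (by rw [hγinv]; linarith) hF hφ hφc hg hgF hg2 hG hTpos hξ hlaw
    hind hx₀ hX
  have hXm : ∀ s ≤ S, Measurable (X s) := fun s hs =>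
    (hspec s hs).1.mono (StagewiseADMM.sampleInfo_le hξ _) le_rfl
  have hXΩ : ∀ s ≤ S, ∀ ω, X s ω ∈ Ω := fun s hs => (hspec s hs).2.1
  have hφi : ∀ s ≤ S, Integrable (fun ω => φ (X s ω)) Pr := fun s hs =>
    StagewiseADMM.integrable_comp_of_isCompact hΩc hφc (hXm s hs) (hXΩ s hs)
  have hei : ∀ s ≤ S, Integrable (fun ω => ‖X s ω - StagewiseADMM.prox Ω φ γ (X s ω)‖ ^ 2) Pr :=
    fun s hs => StagewiseADMM.integrable_comp_of_isCompact
      (φ := fun x => ‖x - StagewiseADMM.prox Ω φ γ x‖ ^ 2) hΩc (by fun_prop) (hXm s hs) (hXΩ s hs)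
  set K := c₁ / 4 * (2 * G ^ 2 + 2 * (2 * μ * D) ^ 2) + ρ ^ 2 / c₂ + ρ * N * D * c₁ * μ / 12
    with hKdef
  have hK : 0 ≤ K := by positivity
  have hmoreau : ∀ x, ‖StagewiseADMM.moreauGrad Ω φ γ x‖ ^ 2
      = (2 * μ) ^ 2 * ‖x - StagewiseADMM.prox Ω φ γ x‖ ^ 2 := by
    intro x
    rw [StagewiseADMM.moreauGrad, norm_smul, mul_pow, Real.norm_eq_abs, sq_abs, hγinv]
  -- the random index selects a stage independently of the samples
  have hindτ : Indep (MeasurableSpace.comap τ inferInstance)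
      (StagewiseADMM.sampleInfo ξ Set.univ) Pr := by
    refine indep_of_indep_of_le_right ((IndepFun_iff_Indep _ _ _).1 hτind) ?_
    refine iSup₂_le fun p _ => ?_
    have h0 : Measurable fun x : ℕ × ℕ → U => x p := measurable_pi_apply p
    have h1 : Measurable[MeasurableSpace.comap (fun ω (p : ℕ × ℕ) => ξ p.1 p.2 ω) inferInstance]
        (ξ p.1 p.2) := h0.comp (comap_measurable fun ω (p : ℕ × ℕ) => ξ p.1 p.2 ω)
    exact h1.comap_le
  have hY := StagewiseADMM.integral_random_index hτ (StagewiseADMM.sampleInfo_le hξ _) hindτ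
    (Y := fun s ω => (2 * μ) ^ 2 * ‖X s ω - StagewiseADMM.prox Ω φ γ (X s ω)‖ ^ 2)
    (fun s hs => by
      have h1 : Measurable fun x => (2 * μ) ^ 2 * ‖x - StagewiseADMM.prox Ω φ γ x‖ ^ 2 := by
        have : Continuous fun x => (2 * μ) ^ 2 * ‖x - StagewiseADMM.prox Ω φ γ x‖ ^ 2 := by
          fun_prop
        exact this.measurable
      exact h1.comp ((hspec s (Nat.lt_succ_iff.1 hs)).1.mono
        (StagewiseADMM.sampleInfo_mono ξ (Set.subset_univ _)) le_rfl))
    (fun s hs => (hei s (Nat.lt_succ_iff.1 hs)).const_mul _)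
  have hXτ : ∀ ω, StagewiseADMM.stagewise Ω ψ A g γ a (fun s => c₁ / (s : ℝ))
      (fun s => c₂ * (s : ℝ)) T x₀ (fun s t => ξ s t ω) (τ ω : ℕ) = X (τ ω) ω := by
    intro ω; rw [hX]
  simp only [hXτ, hmoreau]
  refine ⟨hY.1, hY.2.trans_le ?_⟩
  have hwt : ∀ k : Fin (S + 1), (Pr (τ ⁻¹' {k})).toReal
      = ((k : ℕ) + 1 : ℝ) ^ α / ∑ j ∈ Finset.range (S + 1), ((j : ℝ) + 1) ^ α := by
    intro k
    rw [hprob k, ← Fin.sum_univ_eq_sum_range (fun j => ((j : ℝ) + 1) ^ α),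
      ENNReal.toReal_ofReal (div_nonneg (by positivity)
        (Finset.sum_nonneg fun _ _ => by positivity))]
  simp only [hwt, integral_const_mul]
  rw [Fin.sum_univ_eq_sum_range (fun k => ((k : ℝ) + 1) ^ α
    / (∑ j ∈ Finset.range (S + 1), ((j : ℝ) + 1) ^ α)
    * ((2 * μ) ^ 2 * ∫ ω, ‖X k ω - StagewiseADMM.prox Ω φ γ (X k ω)‖ ^ 2 ∂Pr))]
  refine StagewiseADMM.weighted_average_le hα hΔ hμ hK
    (b := fun s => ∫ ω, φ (X s ω) ∂Pr) ?_ ?_ ?_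
  · intro i hi
    rw [← integral_sub (hφi i hi) (hφi S le_rfl)]
    have h1 := integral_mono ((hφi i hi).sub (hφi S le_rfl)) (integrable_const Δ)
      fun ω => hφΔ _ (hXΩ i hi ω) _ (hXΩ S le_rfl ω)
    simpa using h1
  · intro s hs
    have hs' : s + 1 ∈ Finset.Icc 1 S := Finset.mem_Icc.2 ⟨by omega, hs⟩
    have hs0 := hspos _ hs'
    have h1 := (hspec s hs.le).2.2 hs
    rw [hγinv, hAN] at h1
    have h2 := hT _ hs'
    rw [hγ, hAN] at h2
    have h3 := StagewiseADMM.stage_arithmetic hc₁ hc₂ hρ hD hN hμ ha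
      (fun h => StagewiseADMM.one_le_of_proxMatrix (div_pos hc₁ hs0) (mul_pos hc₂ hs0) (hC _ hs')
        (by rwa [hAN])) hs0 (by exact_mod_cast hTpos _ hs') h2
      (integral_nonneg fun ω => by positivity) h1
    push_cast at h3
    exact h3
  · -- the last point has no stage after it: compare it with its proximal point directly
    have h1 : ∀ ω, 3 * μ / 2 * ‖X S ω - StagewiseADMM.prox Ω φ γ (X S ω)‖ ^ 2 ≤ Δ := by
      intro ω
      obtain ⟨h2, h3⟩ := StagewiseADMM.prox_spec (hex (X S ω))
      have h4 := hφ.growth hΩ h2 (hXΩ S le_rfl ω) h3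
      have h5 := hφΔ _ (hXΩ S le_rfl ω) _ h2
      rw [inv_inv, hγinv, sub_self, norm_zero, norm_sub_rev _ (X S ω)] at h4
      rw [inv_inv] at h5
      linarith
    have h2 := integral_mono ((hei S le_rfl).const_mul (3 * μ / 2)) (integrable_const Δ) h1
    rw [integral_const_mul] at h2
    simpa using h2
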